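/- **Setting.** At each value $\sigma$ of the security parameter, fix a group $\langle g\rangle$ of prime order $q$, a finite key set $K$, a finite set $S$ of possible group secrets, a finite set of digests, finitely many nodes and groups, and an assignment of at most $m$ groups to each node. Each group has a uniformly random secret in $S$. Each node stores an array of $m$ cells holding the secrets of its groups and, in the remaining cells, independent uniformly random elements of $S$; the array is uniformly permuted. The hash $h:\langle g\rangle\to K$ and the keyed hashes $h_k,h'_k:S\to\text{digests}$ are independent random oracles. As functions of $\sigma$, $m$ is polynomially bounded, and each of $q$, $|K|$, $|S|$ eventually exceeds $2^{\sigma}\sigma^{c}$, for every $c$. **Protocol.** The initiator picks a uniformly random $x\in\{1,\dots,q-1\}$ and sends $g^x$. The responder receives $v\ne 1$, picks a uniformly random $y\in\{1,\dots,q-1\}$ and sends $g^y$. The initiator receives $u\neq 1$ and computes $k=h(u^x)$; the responder computes $k=h(v^y)$. (The received elements lie in $\langle g\rangle$; the element $1$ is refused.) We call $u^x$, respectively $v^y$, the Diffie-Hellman value of the run. The initiator sends the list of $h_k(s)$ for the cells $s$ of its array; the responder, after receiving a list, answers with the list of $h'_k(s)$ for its own. **Adversary.** $\mathcal A$ is any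 probabilistic interactive strategy with polynomially many rounds and no limit on its computations (so polynomial-time adversaries are included). It delivers messages of its choice to honest nodes in arbitrarily many concurrent runs in both roles, queries the random oracles, obtains session keys of runs, and corrupts nodes adaptively, reading their arrays. Let $i$ be a node, $G$ a group with $i\in G$, and $D$ any set of groups with $G\in D$ (for example $D=\{G\}$, or all groups of which $\mathcal A$ corrupts no member). $\mathcal A$ may not corrupt a member of a group in $D$; in particular $\mathcal A\notin G$. $\mathcal A$ also interacts, in any number of runs and in both roles, with a *target*. In the real experiment the target is $i$. In the simulated experiment it is a simulator that follows the protocol but knows only those cells of the array of $i$ that hold secrets of groups outside $D$; in each run it puts fresh independent uniformly random elements of $S$ into all other cells. Runs with the honest nodes, including $i$ and other members of $G$, remain available in both experiments. At the end $\mathcal A$ outputs a bit. A *clash* is the event that a run with the target as initiator and another run with an initiator that is the target, or is an honest node sharing a group of $D$ with $i$, end with the same Diffie-Hellman value (so that their session keys are not different). **Lemma (resistance to detection).** For every such $\mathcal A$ and all sufficiently large $\sigma$, $$\bigl|\Pr_{\mathrm{real}}[\mathcal A\to 1,\ \text{no clash}]-\Pr_{\mathrm{sim}}[\mathcal A\to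 1,\ \text{no clash}]\bigr|<2^{-\sigma},$$ $$\bigl|\Pr_{\mathrm{real}}[\mathcal A\to 1]-\Pr_{\mathrm{sim}}[\mathcal A\to 1]\bigr|<\Pr_{\mathrm{real}}[\text{clash}]+2^{-\sigma}.$$ -/

import Mathlib

open Filter Topology

namespace Handshake

/-- The public data of a system at one value of the security parameter: a Diffie-Hellman group of
prime order with a generator, the ranges of the hash functions, the set from which group secrets
are drawn, the nodes, the groups, and who belongs to which groups (at most `m` for each node). -/
structure Setup where
  Elem : Type
  [commGroup : CommGroup Elem]
  [finElem : Finite Elem]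
  gen : Elem
  card_prime : (Nat.card Elem).Prime
  gen_ne_one : gen ≠ 1
  Key : Type
  [finKey : Finite Key]
  [neKey : Nonempty Key]
  Secret : Type
  [finSecret : Finite Secret]
  [neSecret : Nonempty Secret]
  Digest : Type
  [finDigest : Finite Digest]
  [neDigest : Nonempty Digest]
  Node : Type
  [finNode : Finite Node]
  Grp : Type
  [finGrp : Finite Grp]
  m : ℕ
  groups : Node → Finset Grp
  card_groups_le : ∀ p, (groups p).card ≤ m

attribute [instance] Setup.commGroup Setup.finElem Setup.finKey Setup.neKey Setup.finSecret
  Setup.neSecret Setup.finDigest Setup.neDigest Setup.finNode Setup.finGrp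

/-- The two roles in a run (Alice and Bob). They use different keyed hash functions. -/
inductive Role where
  | initiator
  | responder
  deriving DecidableEq

instance : Finite Role :=
  Finite.of_injective (fun ρ : Role => decide (ρ = .initiator)) (by
    intro a b h
    cases a <;> cases b <;> simp_all)

/-- Who is made to take part in a run: an honest node, or the entity under test, which is
either the node `i` or the simulator. -/
inductive Party (P : Setup) where
  | node (p : P.Node)
  | target

/-- All random choices of an execution with `N` rounds, drawn uniformly and independently:
the random oracles `kdf` (the hash `h` of the key exchange) and `mac` (the keyed hash `h_k` for the
initiator and `h'_k` for the responder), the group secrets, the random values in the unused cells,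
the permutations of the arrays, the secret exponents `1, …, q - 1` (see `exponent`) of the runs, and
the fresh values used by the simulator. -/
structure Coins (P : Setup) (N : ℕ) where
  kdf : P.Elem → P.Key
  mac : Role → P.Key → P.Secret → P.Digest
  secret : P.Grp → P.Secret
  filler : P.Node → Fin P.m → P.Secret
  perm : P.Node → Equiv.Perm (Fin P.m)
  expo : Fin N → Fin (Nat.card P.Elem - 1)
  fresh : Fin N → Fin P.m → P.Secret

instance (P : Setup) (N : ℕ) : Finite (Coins P N) := by
  refine Finite.of_injective
    (fun ω : Coins P N =>
      (ω.kdf, ω.mac, ω.secret, ω.filler, ω.perm, ω.expo, ω.fresh)) ?_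
  rintro ⟨⟩ ⟨⟩ h
  simpa using h

instance (P : Setup) (N : ℕ) : Nonempty (Coins P N) := by
  have h := P.card_prime.two_le
  have : NeZero (Nat.card P.Elem - 1) := ⟨by omega⟩
  exact ⟨⟨fun _ => Classical.arbitrary _, fun _ _ _ => Classical.arbitrary _,
    fun _ => Classical.arbitrary _, fun _ _ => Classical.arbitrary _, fun _ => 1,
    fun _ => 0, fun _ _ => Classical.arbitrary _⟩⟩

/-- What the adversary can do in one round. A run is named by the round in which it was started.
* `initiate w`: make `w` start a run as initiator; it answers `g ^ x`.
* `respond w v`: send `v` to `w` as the first message of a run; `w` is responder and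
  answers `g ^ y`.
* `exchange r u`: send `u` to the initiator of run `r`; it computes the session key and answers
  with its list of keyed hashes.
* `membership r H`: send the list `H` to the responder of run `r`; it answers with its own list.
  (The lists that nodes receive enter their local outputs only.)
* `reveal r`: learn the session key of run `r`.
* `kdf z`, `mac ρ k s`: query the random oracles.
* `corrupt p`: read the secrets stored by node `p`. -/
inductive Action (P : Setup) (N : ℕ) where
  | initiate (w : Party P)
  | respond (w : Party P) (v : P.Elem)
  | exchange (r : Fin N) (u : P.Elem)
  | membership (r : Fin N) (H : Fin P.m → P.Digest)
  | reveal (r : Fin N)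
  | kdf (z : P.Elem)
  | mac (ρ : Role) (k : P.Key) (s : P.Secret)
  | corrupt (p : P.Node)

inductive Reply (P : Setup) where
  | refused
  | elem (z : P.Elem)
  | key (k : P.Key)
  | digest (d : P.Digest)
  | digests (f : Fin P.m → P.Digest)
  | secrets (f : Fin P.m → P.Secret)

/-- A probabilistic interactive adversary: a random tape (uniform on a finite set), the
next action and the final guess as functions of the tape and of all replies so far (the latest
reply first). Only the number of rounds is limited, not the computation between the rounds. -/
structure Adversary (P : Setup) where
  rounds : ℕ
  Tape : Type
  [finTape : Finite Tape]
  [neTape : Nonempty Tape]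
  move : Tape → List (Reply P) → Action P rounds
  guess : Tape → List (Reply P) → Bool

attribute [instance] Adversary.finTape Adversary.neTape

/-- The local state of a run: the participant, its role, and the group element it received. -/
structure Session (P : Setup) where
  who : Party P
  role : Role
  peer : Option P.Elem

structure State (P : Setup) (N : ℕ) where
  sessions : Fin N → Option (Session P)
  replies : List (Reply P)

section Protocol

variable {P : Setup} {N : ℕ}

/-- The content of cell `c` of the array of `p` before permutation: the groups of `p` come first,
and `none` marks an unused cell. -/
noncomputable def cell (P : Setup) (p : P.Node) (c : Fin P.m) : Option P.Grp :=
  if h : (c : ℕ) < (P.groups p).card then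
    some ((P.groups p).equivFin.symm ⟨c, h⟩ : P.Grp)
  else none

/-- The array stored by `p`: the secrets of its groups and random values, randomly permuted. -/
noncomputable def array (ω : Coins P N) (p : P.Node) (c : Fin P.m) : P.Secret :=
  match cell P p (ω.perm p c) with
  | some G => ω.secret G
  | none => ω.filler p (ω.perm p c)

open Classical in
/-- The array the simulator of `i` uses in run `r`: it knows nothing of the array of `i` but the
cells that hold secrets of groups outside `D`, and puts fresh random values into all others. -/
noncomputable def simArray (i : P.Node) (D : Finset P.Grp) (ω : Coins P N) (r : Fin N)
    (c : Fin P.m) : P.Secret :=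
  match cell P i (ω.perm i c) with
  | some G => if G ∈ D then ω.fresh r c else ω.secret G
  | none => ω.fresh r c

/-- The secret exponent of the honest participant in run `r`, uniform in `1, …, q - 1`. -/
def exponent (ω : Coins P N) (r : Fin N) : ℕ := (ω.expo r : ℕ) + 1

/-- The array used in run `r` by `w`. If `sim` is true, then the target is the simulator, and
otherwise it is the node `i`. -/
noncomputable def arrayOf (i : P.Node) (D : Finset P.Grp) (sim : Bool) (ω : Coins P N)
    (r : Fin N) : Party P → Fin P.m → P.Secret
  | .node p => array ω p
  | .target => if sim then simArray i D ω r else array ω i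

/-- The session key of run `r` after receipt of `u`. -/
def sessionKey (ω : Coins P N) (r : Fin N) (u : P.Elem) : P.Key :=
  ω.kdf (u ^ exponent ω r)

/-- The list of keyed hashes sent in run `r` by `w` in role `ρ` after receipt of `u`. -/
noncomputable def hashes (i : P.Node) (D : Finset P.Grp) (sim : Bool) (ω : Coins P N)
    (r : Fin N) (w : Party P) (ρ : Role) (u : P.Elem) (c : Fin P.m) : P.Digest :=
  ω.mac ρ (sessionKey ω r u) (arrayOf i D sim ω r w c)

open Classical in
/-- The effect of an action in round `t` on the runs, and the reply to the adversary. Honest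
participants do not accept the neutral element in the key exchange, and the adversary may not
corrupt members of the groups in `D`. -/
noncomputable def answer (i : P.Node) (D : Finset P.Grp) (sim : Bool) (ω : Coins P N)
    (t : Fin N) (S : Fin N → Option (Session P)) :
    Action P N → (Fin N → Option (Session P)) × Reply P
  | .initiate w =>
      (Function.update S t (some ⟨w, .initiator, none⟩), .elem (P.gen ^ exponent ω t))
  | .respond w v =>
      if v = 1 then (S, .refused)
      else (Function.update S t (some ⟨w, .responder, some v⟩), .elem (P.gen ^ exponent ω t))
  | .exchange r u =>
      match S r with
      | some ⟨w, .initiator, none⟩ =>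
          if u = 1 then (S, .refused)
          else (Function.update S r (some ⟨w, .initiator, some u⟩),
            .digests (hashes i D sim ω r w .initiator u))
      | _ => (S, .refused)
  | .membership r _ =>
      match S r with
      | some ⟨w, .responder, some v⟩ => (S, .digests (hashes i D sim ω r w .responder v))
      | _ => (S, .refused)
  | .reveal r =>
      match S r with
      | some ⟨_, _, some u⟩ => (S, .key (sessionKey ω r u))
      | _ => (S, .refused)
  | .kdf z => (S, .key (ω.kdf z))
  | .mac ρ k s => (S, .digest (ω.mac ρ k s))
  | .corrupt p =>
      if Disjoint (P.groups p) D then (S, .secrets (array ω p)) else (S, .refused)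

/-- The state after the first `n` rounds. -/
noncomputable def play (i : P.Node) (D : Finset P.Grp) (sim : Bool) (A : Adversary P)
    (ω : Coins P A.rounds) (τ : A.Tape) : (n : ℕ) → n ≤ A.rounds → State P A.rounds
  | 0, _ => ⟨fun _ => none, []⟩
  | n + 1, h =>
      let s := play i D sim A ω τ n (Nat.le_of_succ_le h)
      let a := answer i D sim ω ⟨n, h⟩ s.sessions (A.move τ s.replies)
      ⟨a.1, a.2 :: s.replies⟩

noncomputable def final (i : P.Node) (D : Finset P.Grp) (sim : Bool) (A : Adversary P)
    (x : Coins P A.rounds × A.Tape) : State P A.rounds :=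
  play i D sim A x.1 x.2 A.rounds le_rfl

/-- The adversary ends with the guess `true`. -/
def Accepts (i : P.Node) (D : Finset P.Grp) (sim : Bool) (A : Adversary P)
    (x : Coins P A.rounds × A.Tape) : Prop :=
  A.guess x.2 (final i D sim A x).replies = true

/-- `w` is the target or an honest node that shares a group of `D` with `i`. -/
def SharesHidden (i : P.Node) (D : Finset P.Grp) : Party P → Prop
  | .node p => ∃ G ∈ D, G ∈ P.groups i ∧ G ∈ P.groups p
  | .target => True

/-- Two runs with both participants in the role of initiator, one the target and
the other sharing a hidden group with it, ended with the same Diffie-Hellman value (so that their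
session keys are not different). -/
def Clash (i : P.Node) (D : Finset P.Grp) (sim : Bool) (A : Adversary P)
    (x : Coins P A.rounds × A.Tape) : Prop :=
  ∃ (r r' : Fin A.rounds) (w : Party P) (u u' : P.Elem),
    r ≠ r' ∧
    (final i D sim A x).sessions r = some ⟨.target, .initiator, some u⟩ ∧
    (final i D sim A x).sessions r' = some ⟨w, .initiator, some u'⟩ ∧
    SharesHidden i D w ∧
    u ^ exponent x.1 r = u' ^ exponent x.1 r'

end Protocol

/-- The probability of an event under the uniform distribution on a finite set. -/
noncomputable def prob {Ω : Type} (E : Ω → Prop) : ℝ :=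
  (Nat.card {x : Ω // E x} : ℝ) / (Nat.card Ω : ℝ)

/-- `f` is bounded by a polynomial in the security parameter. -/
def PolyBounded (f : ℕ → ℕ) : Prop := ∃ p : Polynomial ℕ, ∀ σ, f σ ≤ p.eval σ

/-- `f σ` eventually exceeds `2 ^ σ` by more than any polynomial factor. -/
def Large (f : ℕ → ℕ) : Prop := ∀ c : ℕ, ∀ᶠ σ in atTop, σ ^ c * 2 ^ σ ≤ f σ

end Handshake

/-! The hidden secrets reach the adversary only through random-oracle values at arguments (role,
session key, secret). Such values say nothing about the arguments except which of them coincide.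
`prob_answers_eq` makes this exact for adaptive processes: once a transcript is fixed, all queries
are fixed, and the probability that a uniform function produces this transcript depends only on the
pattern of equalities among the queries.

To compare patterns, pass to a symbolic game in which each hidden secret in an argument is replaced
by its name (`Label`). The execution then never reads the value of a hidden secret, since corruption
yields only unhidden ones. So that value can be resampled afterwards, and any two positions of the
queries with different entries, one of them a name, denote the same secret with probability at most
`1 / |S|`. This covers the adversary's guesses too. Without such a coincidence the real and the
symbolic game have the same pattern (`abs_realProb_sub_symProb_le`).

In the symbolic game, node and simulator give the same pattern unless a hidden name of the target
meets itself in another run, under the same role and the same session key (`symProb_false_eq_true`).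
Within one run both arrays are used consistently. Across runs, `i` repeats its names and the
simulator does not, so a repetition is visible exactly when the keys agree.

Equal keys have three sources (`symProb_keyMatch_le`): a collision of `kdf` at distinct points, of
probability at most `1 / |K|` for each pair of rounds; equal Diffie-Hellman values of two
responders, at most `1 / (q - 1)` for each pair, because a responder draws its exponent after
receiving the peer's element; and equal values of two initiators. The last cannot be excluded, as
the adversary may relay messages between two initiators; this is the clash.

Summing gives `advantageBound`. The second inequality follows from the first, used also with the
trivial guess to compare the two clash probabilities. -/

namespace Handshake

/-! ### Uniform probability on finite sets. -/

section Prob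

variable {Ω Ω' : Type}

theorem prob_nonneg (E : Ω → Prop) : 0 ≤ prob E := by unfold prob; positivity

theorem prob_congr {E F : Ω → Prop} (h : ∀ x, E x ↔ F x) : prob E = prob F := by
  rw [show E = F from funext fun x => propext (h x)]

open Classical in
theorem prob_eq_sum [Fintype Ω] (E : Ω → Prop) :
    prob E = (∑ x, if E x then (1 : ℝ) else 0) / Fintype.card Ω := by
  unfold prob
  rw [Nat.card_eq_fintype_card, Nat.card_eq_fintype_card, Fintype.card_subtype]
  simp

theorem prob_mono [Finite Ω] {E F : Ω → Prop} (h : ∀ x, E x → F x) : prob E ≤ prob F := by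
  unfold prob
  gcongr
  exact Nat.card_le_card_of_injective (fun x : {x // E x} => (⟨x.1, h _ x.2⟩ : {x // F x}))
    fun a b hab => Subtype.ext (congrArg (fun z : {x // F x} => z.1) hab)

theorem prob_equiv (e : Ω ≃ Ω') (E : Ω' → Prop) : prob (fun x => E (e x)) = prob E := by
  unfold prob
  rw [Nat.card_congr e, Nat.card_congr (e.subtypeEquiv (p := fun x => E (e x)) fun _ => Iff.rfl)]

theorem prob_and_add_and_not [Finite Ω] (E F : Ω → Prop) :
    prob (fun x => E x ∧ F x) + prob (fun x => E x ∧ ¬ F x) = prob E := by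
  classical
  have := Fintype.ofFinite Ω
  simp only [prob_eq_sum]
  rw [← add_div, ← Finset.sum_add_distrib]
  congr 1
  refine Finset.sum_congr rfl fun x _ => ?_
  by_cases hE : E x <;> by_cases hF : F x <;> simp [hE, hF]

theorem prob_true [Finite Ω] [Nonempty Ω] : prob (fun _ : Ω => True) = 1 := by
  classical
  have := Fintype.ofFinite Ω
  rw [prob_eq_sum]
  simp

theorem prob_not [Finite Ω] [Nonempty Ω] (E : Ω → Prop) : prob (fun x => ¬ E x) = 1 - prob E := by
  have h := prob_and_add_and_not (fun _ : Ω => True) E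
  rw [prob_true] at h
  simp only [true_and] at h
  linarith

theorem prob_exists_le [Finite Ω] {I : Type} [Fintype I] (E : I → Ω → Prop) :
    prob (fun x => ∃ i, E i x) ≤ ∑ i, prob (E i) := by
  classical
  have := Fintype.ofFinite Ω
  simp only [prob_eq_sum]
  rw [← Finset.sum_div, Finset.sum_comm]
  gcongr with x
  split_ifs with h
  · obtain ⟨i, hi⟩ := h
    refine le_trans ?_ (Finset.single_le_sum (f := fun i => if E i x then (1 : ℝ) else 0)
      (fun j _ => by positivity) (Finset.mem_univ i))
    simp [hi]
  · exact Finset.sum_nonneg fun j _ => by positivity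

theorem prob_or_le [Finite Ω] (E F : Ω → Prop) :
    prob (fun x => E x ∨ F x) ≤ prob E + prob F := by
  rw [← prob_and_add_and_not (fun x => E x ∨ F x) E]
  gcongr
  · exact prob_mono fun x h => h.2
  · exact prob_mono fun x h => h.1.resolve_left h.2

theorem prob_prod {B F : Type} [Fintype B] [Finite F] (E : B → F → Prop) :
    prob (fun x : B × F => E x.1 x.2) = (∑ b, prob (E b)) / Fintype.card B := by
  classical
  have := Fintype.ofFinite F
  simp only [prob_eq_sum]
  rw [← Finset.sum_div, Fintype.card_prod, Fintype.sum_prod_type, Nat.cast_mul, div_div,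
    mul_comm (Fintype.card B : ℝ)]

/-- Conditioning on the first component. The second may range over different sets, as needed for
hash functions with different domains. -/
theorem prob_prod_congr {B F F' : Type} [Finite B] [Finite F] [Finite F'] (E : B → F → Prop)
    (E' : B → F' → Prop) (h : ∀ b, prob (E b) = prob (E' b)) :
    prob (fun x : B × F => E x.1 x.2) = prob (fun x : B × F' => E' x.1 x.2) := by
  have := Fintype.ofFinite B
  simp only [prob_prod, h]

open Classical in
theorem prob_comp_eq_sum [Finite Ω] {A : Type} [Fintype A] (g : Ω → A) (E : A → Prop) :
    prob (fun x => E (g x)) = ∑ a, if E a then prob (fun x => g x = a) else 0 := by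
  have := Fintype.ofFinite Ω
  simp only [prob_eq_sum]
  have : ∀ a, (if E a then (∑ x, if g x = a then (1 : ℝ) else 0) / Fintype.card Ω else 0)
      = (∑ x, if g x = a then (if E a then 1 else 0) else 0) / Fintype.card Ω := by
    intro a
    split_ifs with h <;> simp
  rw [Finset.sum_congr rfl fun a _ => this a, ← Finset.sum_div, Finset.sum_comm]
  simp only [Finset.sum_ite_eq, Finset.mem_univ, if_true]

/-- Restricting a uniformly random function along an injection gives a uniform function. -/
theorem prob_comp_injective {X Y Z : Type} [Finite X] [Finite Y] [Nonempty Y] (e : Z → X)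
    (he : Function.Injective e) (E : (Z → Y) → Prop) :
    prob (fun f : X → Y => E (f ∘ e)) = prob E := by
  classical
  have : Finite Z := Finite.of_injective e he
  have : Fintype ({x // ¬ x ∈ Set.range e} → Y) := Fintype.ofFinite _
  -- A function is its restriction to the range of `e` together with its independent restriction to
  -- the complement.
  let φ : (X → Y) ≃ ({x // ¬ x ∈ Set.range e} → Y) × (Z → Y) :=
    ((Equiv.piEquivPiSubtypeProd (fun x => x ∈ Set.range e) (fun _ => Y)).trans
      (Equiv.prodComm _ _)).trans
      (Equiv.prodCongr (Equiv.refl _)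
        (Equiv.arrowCongr (Equiv.ofInjective e he).symm (Equiv.refl Y)))
  have h1 : ∀ f, (φ f).2 = f ∘ e := by
    intro f; funext z; simp [φ]
  simp only [← h1]
  rw [prob_equiv φ (fun x => E x.2), prob_prod (fun _ => E)]
  simp

/-- If the value of `X` can be resampled and at most one value of `X` leads to `E`, then `E` has
probability at most `1 / |V|`. -/
theorem prob_le_of_resample {V : Type} [Finite Ω] [Nonempty Ω] [Finite V] [Nonempty V]
    (E : Ω → Prop) (X : Ω → V) (upd : Ω → V → Ω)
    (hX : ∀ ω v, E ω → X (upd ω v) = v)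
    (hself : ∀ ω, E ω → upd ω (X ω) = ω)
    (hupd : ∀ ω v v', E ω → upd (upd ω v) v' = upd ω v')
    (huniq : ∀ ω v, E ω → E (upd ω v) → X ω = v) :
    prob E ≤ 1 / Nat.card V := by
  -- The injection embeds `E × V` into `Ω`, whence `|E| * |V| ≤ |Ω|`. If two points of `E` have a
  -- common resampling, then each is a resampling of the other, and `huniq` makes them equal.
  have hinj : Function.Injective (fun y : {ω // E ω} × V => upd y.1 y.2) := by
    rintro ⟨⟨ω, h⟩, v⟩ ⟨⟨ω', h'⟩, v'⟩ he
    simp only at he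
    have hv : v = v' := by rw [← hX ω v h, he, hX ω' v' h']
    subst hv
    have e1 : upd ω (X ω') = ω' := by rw [← hupd ω v _ h, he, hupd ω' v _ h', hself _ h']
    have e2 : X ω = X ω' := huniq ω _ h (e1.symm ▸ h')
    have : ω = ω' := by rw [← hself ω h, e2, e1]
    subst this
    rfl
  have hc := Nat.card_le_card_of_injective _ hinj
  rw [Nat.card_prod] at hc
  unfold prob
  have hV : 0 < Nat.card V := Nat.card_pos
  have hΩ : 0 < Nat.card Ω := Nat.card_pos
  rw [div_le_div_iff₀ (by exact_mod_cast hΩ) (by exact_mod_cast hV), one_mul]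
  exact_mod_cast hc

end Prob

/-! ### Interactive processes with access to a random function. -/

section Oracle

variable {St J X X' Y : Type} {N : ℕ}

/-- The states of an interactive process with `N` rounds that receives the answers `a`. -/
def traj (s₀ : St) (step : Fin N → St → (J → Y) → St) (a : Fin N → J → Y) : ℕ → St
  | 0 => s₀
  | n + 1 =>
      if h : n < N then step ⟨n, h⟩ (traj s₀ step a n) (a ⟨n, h⟩) else traj s₀ step a n

/-- The states of an interactive process whose queries `q` are answered by the function `f`. -/
def run (s₀ : St) (step : Fin N → St → (J → Y) → St) (q : Fin N → St → J → X) (f : X → Y) :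
    ℕ → St
  | 0 => s₀
  | n + 1 =>
      if h : n < N then
        step ⟨n, h⟩ (run s₀ step q f n) (f ∘ q ⟨n, h⟩ (run s₀ step q f n))
      else run s₀ step q f n

/-- The answers that `f` gives to an interactive process. -/
def answers (s₀ : St) (step : Fin N → St → (J → Y) → St) (q : Fin N → St → J → X) (f : X → Y)
    (n : Fin N) : J → Y :=
  f ∘ q n (run s₀ step q f n)

variable (s₀ : St) (step : Fin N → St → (J → Y) → St) (q : Fin N → St → J → X)
  (q' : Fin N → St → J → X')

theorem traj_answers (f : X → Y) (n : ℕ) :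
    traj s₀ step (answers s₀ step q f) n = run s₀ step q f n := by
  induction n with
  | zero => rfl
  | succ n ih =>
    simp only [traj, run]
    split_ifs with h
    · rw [ih]; rfl
    · exact ih

/-- Removes adaptivity: for a prescribed transcript `a` the states, hence the queries, no longer
depend on `f`, and the event is a list of interpolation conditions. -/
theorem answers_eq_iff (f : X → Y) (a : Fin N → J → Y) :
    answers s₀ step q f = a ↔ ∀ p : Fin N × J, f (q p.1 (traj s₀ step a p.1) p.2) = a p.1 p.2 := by
  constructor
  · rintro rfl p
    rw [traj_answers]
    rfl
  · intro h
    have key : ∀ n, run s₀ step q f n = traj s₀ step a n := by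
      intro n
      induction n with
      | zero => rfl
      | succ n ih =>
        simp only [traj, run]
        split_ifs with hn
        · rw [ih]
          congr 1
          funext j
          exact h (⟨n, hn⟩, j)
        · exact ih
    funext n j
    rw [answers, key]
    exact h (n, j)

/-- Only the values on the range of `Q` matter. The equality pattern identifies this range with that
of `Q'`, and a uniform function restricts to a uniform function on either. -/
theorem prob_interpolate [Finite X] [Finite X'] [Finite Y] [Nonempty Y] {I : Type} (Q : I → X)
    (Q' : I → X') (h : ∀ i j, Q i = Q j ↔ Q' i = Q' j) (a : I → Y) :
    prob (fun f : X → Y => ∀ i, f (Q i) = a i) = prob (fun f : X' → Y => ∀ i, f (Q' i) = a i) := by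
  let e : Set.range Q → X' := fun z => Q' z.2.choose
  have he : ∀ i, e ⟨Q i, i, rfl⟩ = Q' i := fun i =>
    (h _ _).1 (Exists.choose_spec (⟨i, rfl⟩ : ∃ j, Q j = Q i))
  have hinj : Function.Injective e := by
    rintro ⟨_, i, rfl⟩ ⟨_, j, rfl⟩ hij
    rw [he, he] at hij
    exact Subtype.ext ((h i j).2 hij)
  let E : (Set.range Q → Y) → Prop := fun g => ∀ i, g ⟨Q i, i, rfl⟩ = a i
  have h1 := prob_comp_injective (Y := Y) (Subtype.val : Set.range Q → X) Subtype.val_injective E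
  have h2 := prob_comp_injective (Y := Y) e hinj E
  simp only [E, Function.comp_apply, he] at h1 h2
  rw [h1, h2]

/-- Two interactive processes that differ only in their queries to a random function are
indistinguishable as long as their queries show the same pattern of repetitions. -/
theorem prob_answers_eq [Finite X] [Finite X'] [Finite Y] [Nonempty Y] [Finite J]
    (E : (Fin N → J → Y) → Prop)
    (h : ∀ a, E a → ∀ p p' : Fin N × J,
      q p.1 (traj s₀ step a p.1) p.2 = q p'.1 (traj s₀ step a p'.1) p'.2 ↔
      q' p.1 (traj s₀ step a p.1) p.2 = q' p'.1 (traj s₀ step a p'.1) p'.2) :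
    prob (fun f : X → Y => E (answers s₀ step q f)) =
      prob (fun f : X' → Y => E (answers s₀ step q' f)) := by
  classical
  have := Fintype.ofFinite (Fin N → J → Y)
  rw [prob_comp_eq_sum, prob_comp_eq_sum]
  refine Finset.sum_congr rfl fun a _ => ?_
  split_ifs with ha
  · simp only [answers_eq_iff]
    exact prob_interpolate _ _ (h a ha) _
  · rfl

theorem prob_answers_prod_eq {B : Type} [Finite B] [Finite X] [Finite X'] [Finite Y] [Nonempty Y]
    [Finite J] (step : B → Fin N → St → (J → Y) → St) (q : B → Fin N → St → J → X)
    (q' : B → Fin N → St → J → X') (E : B → (Fin N → J → Y) → Prop)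
    (h : ∀ b a, E b a → ∀ p p' : Fin N × J,
      q b p.1 (traj s₀ (step b) a p.1) p.2 = q b p'.1 (traj s₀ (step b) a p'.1) p'.2 ↔
      q' b p.1 (traj s₀ (step b) a p.1) p.2 = q' b p'.1 (traj s₀ (step b) a p'.1) p'.2) :
    prob (fun x : B × (X → Y) => E x.1 (answers s₀ (step x.1) (q x.1) x.2)) =
      prob (fun x : B × (X' → Y) => E x.1 (answers s₀ (step x.1) (q' x.1) x.2)) :=
  prob_prod_congr (fun b f => E b (answers s₀ (step b) (q b) f))
    (fun b f => E b (answers s₀ (step b) (q' b) f)) fun b =>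
    prob_answers_eq s₀ (step b) (q b) (q' b) (E b) (h b)

end Oracle

/-- Names of the random secrets of an execution: the secret of a group, the value in an unused
cell of a node, the fresh value of the simulator in a cell for one run. -/
inductive Label (P : Setup) (N : ℕ) where
  | grp (G : P.Grp)
  | filler (p : P.Node) (c : Fin P.m)
  | fresh (r : Fin N) (c : Fin P.m)

instance (P : Setup) (N : ℕ) : Finite (Label P N) := by
  let f : Label P N → P.Grp ⊕ (P.Node × Fin P.m) ⊕ (Fin N × Fin P.m)
    | .grp G => .inl G
    | .filler p c => .inr (.inl (p, c))
    | .fresh r c => .inr (.inr (r, c))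
  refine Finite.of_injective f ?_
  intro a b h
  cases a <;> cases b <;> simp_all [f]

/-- All random choices other than the keyed hash functions. -/
structure Base (P : Setup) (N : ℕ) where
  kdf : P.Elem → P.Key
  perm : P.Node → Equiv.Perm (Fin P.m)
  expo : Fin N → Fin (Nat.card P.Elem - 1)
  val : Label P N → P.Secret

/-- The points at which the keyed hash functions are evaluated in one round: at the array that `w`
uses in run `r` with the key after receipt of `u`, or at a single secret. -/
inductive Query (P : Setup) (N : ℕ) where
  | hash (r : Fin N) (w : Party P) (ρ : Role) (u : P.Elem)
  | plain (ρ : Role) (k : P.Key) (s : P.Secret)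

/-! ### The protocol as an interactive process, and its symbolic form. -/

section Game

variable {P : Setup} {N : ℕ}

/-- The coins of an execution, split into the keyed hash functions and all others. -/
def coinsEquiv : Coins P N ≃ Base P N × (Role × P.Key × P.Secret → P.Digest) where
  toFun ω := (⟨ω.kdf, ω.perm, ω.expo, fun
    | .grp G => ω.secret G
    | .filler p c => ω.filler p c
    | .fresh r c => ω.fresh r c⟩, fun x => ω.mac x.1 x.2.1 x.2.2)
  invFun x := ⟨x.1.kdf, fun ρ k s => x.2 (ρ, k, s), fun G => x.1.val (.grp G),
    fun p c => x.1.val (.filler p c), x.1.perm, x.1.expo, fun r c => x.1.val (.fresh r c)⟩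
  left_inv _ := rfl
  right_inv := by
    rintro ⟨⟨kdf, perm, expo, val⟩, f⟩
    simp only [Prod.mk.injEq, Base.mk.injEq, true_and, and_true]
    funext ℓ
    cases ℓ <;> rfl

instance : Finite (Base P N) :=
  Finite.of_injective (fun b : Base P N => (b.kdf, b.perm, b.expo, b.val)) (by
    rintro ⟨⟩ ⟨⟩ h
    simpa using h)

instance : Nonempty (Base P N) := (Nonempty.map (fun ω => (coinsEquiv ω).1) inferInstance :
  Nonempty (Base P N))

/-- The secret exponent of the honest participant in run `r`. -/
def Base.exp (b : Base P N) (r : Fin N) : ℕ := (b.expo r : ℕ) + 1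

/-- The name of the secret in cell `c` of the array of `p`. -/
noncomputable def nodeLabel (perm : P.Node → Equiv.Perm (Fin P.m)) (p : P.Node) (c : Fin P.m) :
    Label P N :=
  match cell P p (perm p c) with
  | some G => .grp G
  | none => .filler p (perm p c)

open Classical in
/-- The name of the secret in cell `c` of the array of the simulator in run `r`. -/
noncomputable def simLabel (i : P.Node) (D : Finset P.Grp)
    (perm : P.Node → Equiv.Perm (Fin P.m)) (r : Fin N) (c : Fin P.m) : Label P N :=
  match cell P i (perm i c) with
  | some G => if G ∈ D then .fresh r c else .grp G
  | none => .fresh r c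

/-- The name of the secret in cell `c` of the array that `w` uses in run `r`. -/
noncomputable def label (i : P.Node) (D : Finset P.Grp) (sim : Bool)
    (perm : P.Node → Equiv.Perm (Fin P.m)) (r : Fin N) : Party P → Fin P.m → Label P N
  | .node p => nodeLabel perm p
  | .target => if sim then simLabel i D perm r else nodeLabel perm i

/-- The secrets that the adversary cannot obtain by corruption: those of the groups in `D`, those
in the unused cells of `i`, and the fresh values of the simulator. -/
def Hidden (i : P.Node) (D : Finset P.Grp) : Label P N → Prop
  | .grp G => G ∈ D
  | .filler p _ => p = i
  | .fresh _ _ => True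

open Classical in
/-- A secret, represented by its name if it is hidden. -/
noncomputable def symb (i : P.Node) (D : Finset P.Grp) (val : Label P N → P.Secret)
    (ℓ : Label P N) : P.Secret ⊕ Label P N :=
  if Hidden i D ℓ then .inr ℓ else .inl (val ℓ)

theorem elim_symb (i : P.Node) (D : Finset P.Grp) (val : Label P N → P.Secret) (ℓ : Label P N) :
    Sum.elim id val (symb i D val ℓ) = val ℓ := by
  unfold symb
  split_ifs <;> rfl

/-- The arguments of the keyed hash function, with names in place of hidden secrets. -/
noncomputable def point (i : P.Node) (D : Finset P.Grp) (sim : Bool) (b : Base P N) :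
    Query P N → Fin P.m → Role × P.Key × (P.Secret ⊕ Label P N)
  | .hash r w ρ u, c =>
      (ρ, b.kdf (u ^ b.exp r), symb i D b.val (label i D sim b.perm r w c))
  | .plain ρ k s, _ => (ρ, k, .inl s)

open Classical in
/-- The points at which the keyed hash functions are evaluated in answer to an action. -/
noncomputable def query (S : Fin N → Option (Session P)) : Action P N → Query P N
  | .exchange r u =>
      match S r with
      | some ⟨w, .initiator, none⟩ =>
          -- A dummy query: every round must ask something, and `advance` ignores the answer in the
          -- rounds that need none.
          if u = 1 then .plain .initiator (Classical.arbitrary _) (Classical.arbitrary _)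
          else .hash r w .initiator u
      | _ => .plain .initiator (Classical.arbitrary _) (Classical.arbitrary _)
  | .membership r _ =>
      match S r with
      | some ⟨w, .responder, some v⟩ => .hash r w .responder v
      | _ => .plain .initiator (Classical.arbitrary _) (Classical.arbitrary _)
  | .mac ρ k s => .plain ρ k s
  | _ => .plain .initiator (Classical.arbitrary _) (Classical.arbitrary _)

open Classical in
/-- The effect of an action in round `t` if the keyed hash functions give the values `a`. -/
noncomputable def advance (hm : 0 < P.m) (D : Finset P.Grp) (b : Base P N)
    (t : Fin N) (S : Fin N → Option (Session P)) (a : Fin P.m → P.Digest) :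
    Action P N → (Fin N → Option (Session P)) × Reply P
  | .initiate w =>
      (Function.update S t (some ⟨w, .initiator, none⟩), .elem (P.gen ^ b.exp t))
  | .respond w v =>
      if v = 1 then (S, .refused)
      else (Function.update S t (some ⟨w, .responder, some v⟩), .elem (P.gen ^ b.exp t))
  | .exchange r u =>
      match S r with
      | some ⟨w, .initiator, none⟩ =>
          if u = 1 then (S, .refused)
          else (Function.update S r (some ⟨w, .initiator, some u⟩), .digests a)
      | _ => (S, .refused)
  | .membership r _ =>
      match S r with
      | some ⟨_, .responder, some _⟩ => (S, .digests a)
      | _ => (S, .refused)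
  | .reveal r =>
      match S r with
      | some ⟨_, _, some u⟩ => (S, .key (b.kdf (u ^ b.exp r)))
      | _ => (S, .refused)
  | .kdf z => (S, .key (b.kdf z))
  -- A plain query is the same in all `m` coordinates, so coordinate 0 carries its answer.
  | .mac _ _ _ => (S, .digest (a ⟨0, hm⟩))
  | .corrupt p =>
      if Disjoint (P.groups p) D then (S, .secrets fun c => b.val (nodeLabel b.perm p c))
      else (S, .refused)

/-- The state before the first round. -/
def start : State P N := ⟨fun _ => none, []⟩

/-- One round of the adversary `A` with tape `τ`. -/
noncomputable def round (hm : 0 < P.m) (D : Finset P.Grp) (A : Adversary P)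
    (b : Base P A.rounds) (τ : A.Tape) (t : Fin A.rounds) (s : State P A.rounds)
    (a : Fin P.m → P.Digest) : State P A.rounds :=
  let z := advance hm D b t s.sessions a (A.move τ s.replies)
  ⟨z.1, z.2 :: s.replies⟩

/-- The arguments of the keyed hash function in the round after state `s`, with names in place of
hidden secrets. -/
noncomputable def symPoint (i : P.Node) (D : Finset P.Grp) (sim : Bool) (A : Adversary P)
    (b : Base P A.rounds) (τ : A.Tape) (_ : Fin A.rounds) (s : State P A.rounds) :
    Fin P.m → Role × P.Key × (P.Secret ⊕ Label P A.rounds) :=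
  point i D sim b (query s.sessions (A.move τ s.replies))

/-- The arguments of the keyed hash function in the round after state `s`. -/
noncomputable def realPoint (i : P.Node) (D : Finset P.Grp) (sim : Bool) (A : Adversary P)
    (b : Base P A.rounds) (τ : A.Tape) (t : Fin A.rounds) (s : State P A.rounds) (c : Fin P.m) :
    Role × P.Key × P.Secret :=
  let x := symPoint i D sim A b τ t s c
  (x.1, x.2.1, Sum.elim id b.val x.2.2)

theorem val_nodeLabel (ω : Coins P N) (p : P.Node) (c : Fin P.m) :
    (coinsEquiv ω).1.val (nodeLabel (coinsEquiv ω).1.perm p c) = array ω p c := by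
  have : (coinsEquiv ω).1.perm = ω.perm := rfl
  rw [this]
  unfold nodeLabel array
  cases cell P p (ω.perm p c) <;> rfl

theorem val_label (i : P.Node) (D : Finset P.Grp) (sim : Bool) (ω : Coins P N) (r : Fin N)
    (w : Party P) (c : Fin P.m) :
    (coinsEquiv ω).1.val (label i D sim (coinsEquiv ω).1.perm r w c) =
      arrayOf i D sim ω r w c := by
  cases w with
  | node p => exact val_nodeLabel ω p c
  | target =>
    cases sim with
    | false => exact val_nodeLabel ω i c
    | true =>
      have : (coinsEquiv ω).1.perm = ω.perm := rfl
      simp only [label, arrayOf, if_true, this, simLabel, simArray]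
      cases cell P i (ω.perm i c) with
      | none => rfl
      | some G =>
        simp only
        split_ifs <;> rfl

/-- Isolates the keyed hashes: `advance` sees neither `mac` nor `sim`, so the two experiments differ
only in the points queried. -/
theorem answer_eq_advance (hm : 0 < P.m) (i : P.Node) (D : Finset P.Grp) (sim : Bool)
    (ω : Coins P N) (t : Fin N) (S : Fin N → Option (Session P)) (act : Action P N) :
    answer i D sim ω t S act =
      advance hm D (coinsEquiv ω).1 t S (fun c =>
        let x := point i D sim (coinsEquiv ω).1 (query S act) c
        (coinsEquiv ω).2 (x.1, x.2.1, Sum.elim id (coinsEquiv ω).1.val x.2.2)) act := by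
  have hh : ∀ r w ρ u, hashes i D sim ω r w ρ u = fun c =>
      (coinsEquiv ω).2 (ρ, (coinsEquiv ω).1.kdf (u ^ (coinsEquiv ω).1.exp r),
        arrayOf i D sim ω r w c) := fun r w ρ u => rfl
  cases act with
  | exchange r u =>
    simp only [answer, advance, query]
    rcases S r with _ | ⟨w, _ | _, _ | v⟩ <;> simp only
    split_ifs
    · rfl
    · simp only [point, elim_symb, val_label, hh]
  | membership r H =>
    simp only [answer, advance, query]
    rcases S r with _ | ⟨w, _ | _, _ | v⟩ <;> simp only
    simp only [point, elim_symb, val_label, hh]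
  | corrupt p =>
    simp only [answer, advance, val_nodeLabel]
  | initiate w => rfl
  | respond w v => rfl
  | reveal r =>
    simp only [answer, advance]
    rcases S r with _ | ⟨w, _ | _, _ | v⟩ <;> rfl
  | kdf z => rfl
  | mac ρ k s => rfl

theorem play_eq_run (hm : 0 < P.m) (i : P.Node) (D : Finset P.Grp) (sim : Bool)
    (A : Adversary P) (ω : Coins P A.rounds) (τ : A.Tape) (n : ℕ) (hn : n ≤ A.rounds) :
    play i D sim A ω τ n hn =
      run start (round hm D A (coinsEquiv ω).1 τ) (realPoint i D sim A (coinsEquiv ω).1 τ)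
        (coinsEquiv ω).2 n := by
  induction n with
  | zero => rfl
  | succ n ih =>
    have hlt : n < A.rounds := hn
    simp only [play, run, hlt, dif_pos, ih (Nat.le_of_succ_le hn), answer_eq_advance hm]
    rfl

end Game

/-! ### Invariants along a trajectory. -/

section Oracle

variable {St J X Y : Type} {N : ℕ} (s₀ : St) (step : Fin N → St → (J → Y) → St)

theorem traj_succ (a : Fin N → J → Y) (t : Fin N) :
    traj s₀ step a (t + 1) = step t (traj s₀ step a t) (a t) := by
  simp [traj]

theorem traj_invariant (a : Fin N → J → Y) (Inv : ℕ → St → Prop) (h₀ : Inv 0 s₀)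
    (h : ∀ (t : Fin N), Inv t (traj s₀ step a t) →
      Inv (t + 1) (step t (traj s₀ step a t) (a t)))
    (n : ℕ) (hn : n ≤ N) : Inv n (traj s₀ step a n) := by
  induction n with
  | zero => exact h₀
  | succ n ih =>
    have := h ⟨n, hn⟩ (ih (Nat.le_of_succ_le hn))
    rw [← traj_succ s₀ step a ⟨n, hn⟩] at this
    exact this

end Oracle

/-! ### Evolution of the runs. -/

section Sessions

variable {P : Setup} (hm : 0 < P.m) (D : Finset P.Grp)

theorem advance_fst {N : ℕ} (b : Base P N) (t : Fin N) (S : Fin N → Option (Session P))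
    (a : Fin P.m → P.Digest) (act : Action P N) :
    (advance hm D b t S a act).1 = S ∨
    (∃ w, act = .initiate w ∧
      (advance hm D b t S a act).1 = Function.update S t (some ⟨w, .initiator, none⟩)) ∨
    (∃ w v, act = .respond w v ∧ v ≠ 1 ∧
      (advance hm D b t S a act).1 = Function.update S t (some ⟨w, .responder, some v⟩)) ∨
    (∃ r w u, act = .exchange r u ∧ S r = some ⟨w, .initiator, none⟩ ∧
      (advance hm D b t S a act).1 = Function.update S r (some ⟨w, .initiator, some u⟩)) := by
  cases act with
  | exchange r u =>
    simp only [advance]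
    rcases h : S r with _ | ⟨w, _ | _, _ | v⟩
    case exchange.some.initiator.none =>
      simp only
      split_ifs
      · exact Or.inl rfl
      · exact Or.inr (Or.inr (Or.inr ⟨r, w, u, rfl, h, rfl⟩))
    all_goals exact Or.inl rfl
  | membership r H =>
    simp only [advance]
    rcases S r with _ | ⟨w, _ | _, _ | v⟩ <;> exact Or.inl rfl
  | corrupt p =>
    simp only [advance]
    split_ifs <;> exact Or.inl rfl
  | initiate w => exact Or.inr (Or.inl ⟨w, rfl, rfl⟩)
  | respond w v =>
    simp only [advance]
    split_ifs with h
    · exact Or.inl rfl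
    · exact Or.inr (Or.inr (Or.inl ⟨w, v, rfl, h, rfl⟩))
  | reveal r =>
    simp only [advance]
    rcases S r with _ | ⟨w, _ | _, _ | v⟩ <;> exact Or.inl rfl
  | kdf z => exact Or.inl rfl
  | mac ρ k s => exact Or.inl rfl

/-- The point at which `kdf` is, or may later be, evaluated because of an action in round `t`. -/
def touch {N : ℕ} (b : Base P N) (t : Fin N) : Action P N → P.Elem
  | .respond _ v => v ^ b.exp t
  | .exchange r u => u ^ b.exp r
  | .kdf z => z
  -- The remaining actions use `kdf` at most at points touched when the run received its element, so
  -- any harmless default will do.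
  | _ => 1

variable (A : Adversary P) (b : Base P A.rounds) (τ : A.Tape)
  (a : Fin A.rounds → Fin P.m → P.Digest)

/-- The states of the execution in which the keyed hash functions give the values `a`. -/
noncomputable def stateAt (n : ℕ) : State P A.rounds := traj start (round hm D A b τ) a n

/-- The action in round `t` of the execution in which the keyed hash functions give the
values `a`. -/
noncomputable def actionAt (t : Fin A.rounds) : Action P A.rounds :=
  A.move τ (stateAt hm D A b τ a t).replies

theorem stateAt_sessions_succ (t : Fin A.rounds) :
    (stateAt hm D A b τ a (t + 1)).sessions =
      (advance hm D b t (stateAt hm D A b τ a t).sessions (a t)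
        (actionAt hm D A b τ a t)).1 := by
  unfold stateAt
  rw [traj_succ]
  rfl

theorem stateAt_invariant (Inv : ℕ → (Fin A.rounds → Option (Session P)) → Prop)
    (h₀ : Inv 0 fun _ => none)
    (h : ∀ t : Fin A.rounds, Inv t (stateAt hm D A b τ a t).sessions →
      Inv (t + 1) (stateAt hm D A b τ a (t + 1)).sessions) (n : ℕ) (hn : n ≤ A.rounds) :
    Inv n (stateAt hm D A b τ a n).sessions := by
  refine traj_invariant start (round hm D A b τ) a (fun n s => Inv n s.sessions) h₀ ?_ n hn
  intro t ht
  rw [← traj_succ start (round hm D A b τ) a t]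
  exact h t ht

/-- A run is named by its starting round. Hence the exponent of round `t` is not in use before round
`t`. -/
theorem lt_of_session {n : ℕ} (hn : n ≤ A.rounds) {r : Fin A.rounds} {s : Session P}
    (h : (stateAt hm D A b τ a n).sessions r = some s) : (r : ℕ) < n := by
  refine stateAt_invariant hm D A b τ a (fun n S => ∀ r s, S r = some s → (r : ℕ) < n)
    (by simp) ?_ n hn r s h
  intro t ih r s hs
  rw [stateAt_sessions_succ] at hs
  rcases advance_fst hm D b t (stateAt hm D A b τ a t).sessions (a t) (actionAt hm D A b τ a t)
    with h | ⟨w, -, h⟩ | ⟨w, v, -, -, h⟩ | ⟨r', w, u, -, h', h⟩ <;> rw [h] at hs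
  · exact Nat.lt_succ_of_lt (ih r s hs)
  · by_cases hr : r = t
    · subst hr; exact Nat.lt_succ_self _
    · rw [Function.update_of_ne hr] at hs
      exact Nat.lt_succ_of_lt (ih r s hs)
  · by_cases hr : r = t
    · subst hr; exact Nat.lt_succ_self _
    · rw [Function.update_of_ne hr] at hs
      exact Nat.lt_succ_of_lt (ih r s hs)
  · by_cases hr : r = r'
    · subst hr; exact Nat.lt_succ_of_lt (ih r _ h')
    · rw [Function.update_of_ne hr] at hs
      exact Nat.lt_succ_of_lt (ih r s hs)

/-- A new run takes the number of the current round, which is larger than `r`, and an exchange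
alters only runs that have not yet received an element. -/
theorem session_persists {n n' : ℕ} (hnn : n ≤ n') (hn : n' ≤ A.rounds) {r : Fin A.rounds}
    {w : Party P} {ρ : Role} {u : P.Elem}
    (h : (stateAt hm D A b τ a n).sessions r = some ⟨w, ρ, some u⟩) :
    (stateAt hm D A b τ a n').sessions r = some ⟨w, ρ, some u⟩ := by
  induction n', hnn using Nat.le_induction with
  | base => exact h
  | succ k hk ih =>
    have ih := ih (Nat.le_of_succ_le hn)
    have hlt := lt_of_session hm D A b τ a (Nat.le_of_succ_le hn) ih
    have e := stateAt_sessions_succ hm D A b τ a ⟨k, hn⟩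
    simp only at e
    rw [e]
    have hne : r ≠ ⟨k, hn⟩ := fun hr => by rw [hr] at hlt; exact lt_irrefl _ hlt
    rcases advance_fst hm D b ⟨k, hn⟩ (stateAt hm D A b τ a k).sessions (a ⟨k, hn⟩)
      (actionAt hm D A b τ a ⟨k, hn⟩)
      with h | ⟨w, -, h⟩ | ⟨w, v, -, -, h⟩ | ⟨r', w, u, -, h', h⟩ <;> rw [h]
    · exact ih
    · rw [Function.update_of_ne hne]; exact ih
    · rw [Function.update_of_ne hne]; exact ih
    · have : r ≠ r' := fun hr => by
        subst hr
        rw [ih] at h'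
        simp at h'
      rw [Function.update_of_ne this]; exact ih

/-- Lets one condition on the final state control every pair of hash queries made during the
execution. -/
theorem session_of_query {t : Fin A.rounds} {r : Fin A.rounds} {w : Party P} {ρ : Role}
    {u : P.Elem}
    (h : query (stateAt hm D A b τ a t).sessions (actionAt hm D A b τ a t) = .hash r w ρ u) :
    (stateAt hm D A b τ a A.rounds).sessions r = some ⟨w, ρ, some u⟩ := by
  suffices (stateAt hm D A b τ a (t + 1)).sessions r = some ⟨w, ρ, some u⟩ from
    session_persists hm D A b τ a t.2 le_rfl this
  rw [stateAt_sessions_succ]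
  generalize (stateAt hm D A b τ a t).sessions = S at *
  generalize actionAt hm D A b τ a t = act at *
  cases act with
  | exchange r' u' =>
    simp only [query] at h
    rcases hS : S r' with _ | ⟨w', _ | _, _ | v⟩ <;> simp only [hS] at h
    case exchange.some.initiator.none =>
      split_ifs at h with h1
      cases h
      simp [advance, hS, h1]
    all_goals simp at h
  | membership r' H =>
    simp only [query] at h
    rcases hS : S r' with _ | ⟨w', _ | _, _ | v⟩ <;> simp only [hS] at h
    case membership.some.responder.some =>
      cases h
      simp [advance, hS]
    all_goals simp at h
  | _ => simp [query] at h

/-- The element given to a responder is fixed by the action that starts its run, before the exponent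
of that run has any effect. Initiators lack this property. -/
theorem respond_of_session {n : ℕ} (hn : n ≤ A.rounds) {r : Fin A.rounds} {w : Party P}
    {u : Option P.Elem}
    (h : (stateAt hm D A b τ a n).sessions r = some ⟨w, .responder, u⟩) :
    ∃ v, u = some v ∧ v ≠ 1 ∧ actionAt hm D A b τ a r = .respond w v := by
  refine stateAt_invariant hm D A b τ a
    (fun _ S => ∀ r w u, S r = some ⟨w, .responder, u⟩ →
      ∃ v, u = some v ∧ v ≠ 1 ∧ actionAt hm D A b τ a r = .respond w v)
    (by simp) ?_ n hn r w u h
  intro t ih r w u hs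
  rw [stateAt_sessions_succ] at hs
  rcases advance_fst hm D b t (stateAt hm D A b τ a t).sessions (a t) (actionAt hm D A b τ a t)
    with h | ⟨w', -, h⟩ | ⟨w', v, hact, hv, h⟩ | ⟨r', w', u', -, h', h⟩ <;> rw [h] at hs
  · exact ih r w u hs
  · by_cases hr : r = t
    · subst hr; simp at hs
    · rw [Function.update_of_ne hr] at hs
      exact ih r w u hs
  · by_cases hr : r = t
    · subst hr
      simp only [Function.update_self, Option.some.injEq, Session.mk.injEq, true_and] at hs
      obtain ⟨rfl, rfl⟩ := hs
      exact ⟨v, rfl, hv, hact⟩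
    · rw [Function.update_of_ne hr] at hs
      exact ih r w u hs
  · by_cases hr : r = r'
    · subst hr; simp at hs
    · rw [Function.update_of_ne hr] at hs
      exact ih r w u hs

theorem touch_of_session {n : ℕ} (hn : n ≤ A.rounds) {r : Fin A.rounds} {w : Party P}
    {ρ : Role} {u : P.Elem}
    (h : (stateAt hm D A b τ a n).sessions r = some ⟨w, ρ, some u⟩) :
    ∃ j : Fin A.rounds, (j : ℕ) < n ∧ touch b j (actionAt hm D A b τ a j) = u ^ b.exp r := by
  refine stateAt_invariant hm D A b τ a
    (fun n S => ∀ r w ρ u, S r = some ⟨w, ρ, some u⟩ →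
      ∃ j : Fin A.rounds, (j : ℕ) < n ∧ touch b j (actionAt hm D A b τ a j) = u ^ b.exp r)
    (by simp) ?_ n hn r w ρ u h
  intro t ih r w ρ u hs
  have ih' (hs : (stateAt hm D A b τ a t).sessions r = some ⟨w, ρ, some u⟩) :
      ∃ j : Fin A.rounds, (j : ℕ) < t + 1 ∧
        touch b j (actionAt hm D A b τ a j) = u ^ b.exp r :=
    (ih r w ρ u hs).imp fun j hj => ⟨Nat.lt_succ_of_lt hj.1, hj.2⟩
  rw [stateAt_sessions_succ] at hs
  rcases advance_fst hm D b t (stateAt hm D A b τ a t).sessions (a t) (actionAt hm D A b τ a t)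
    with h | ⟨w', -, h⟩ | ⟨w', v, hact, hv, h⟩ | ⟨r', w', u', hact, h', h⟩ <;> rw [h] at hs
  · exact ih' hs
  · by_cases hr : r = t
    · subst hr; simp at hs
    · rw [Function.update_of_ne hr] at hs
      exact ih' hs
  · by_cases hr : r = t
    · subst hr
      simp only [Function.update_self, Option.some.injEq, Session.mk.injEq] at hs
      obtain ⟨rfl, rfl, rfl⟩ := hs
      exact ⟨r, Nat.lt_succ_self _, by rw [hact]; rfl⟩
    · rw [Function.update_of_ne hr] at hs
      exact ih' hs
  · by_cases hr : r = r'
    · subst hr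
      simp only [Function.update_self, Option.some.injEq, Session.mk.injEq] at hs
      obtain ⟨rfl, rfl, rfl⟩ := hs
      exact ⟨t, Nat.lt_succ_self _, by rw [hact]; rfl⟩
    · rw [Function.update_of_ne hr] at hs
      exact ih' hs

end Sessions

/-! ### Equality patterns of named secrets. -/

section Labels

variable {P : Setup} {N : ℕ} {i : P.Node} {D : Finset P.Grp}

theorem symb_eq_inr {val : Label P N → P.Secret} {ℓ ℓ' : Label P N}
    (h : symb i D val ℓ = .inr ℓ') : ℓ = ℓ' ∧ Hidden i D ℓ := by
  unfold symb at h
  split_ifs at h with hh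
  exact ⟨Sum.inr.inj h, hh⟩

theorem mem_groups_of_cell {p : P.Node} {c : Fin P.m} {G : P.Grp} (h : cell P p c = some G) :
    G ∈ P.groups p := by
  unfold cell at h
  split_ifs at h
  rw [Option.some.injEq] at h
  rw [← h]
  exact Subtype.prop _

theorem cell_injective {p : P.Node} {c c' : Fin P.m} {G : P.Grp} (h : cell P p c = some G)
    (h' : cell P p c' = some G) : c = c' := by
  unfold cell at h h'
  split_ifs at h h'
  rw [Option.some.injEq] at h h'
  have := (P.groups p).equivFin.symm.injective (Subtype.ext (h.trans h'.symm))
  simpa [Fin.ext_iff] using this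

theorem nodeLabel_injective (perm : P.Node → Equiv.Perm (Fin P.m)) (p : P.Node) :
    Function.Injective (nodeLabel (N := N) perm p) := by
  intro c c' h
  unfold nodeLabel at h
  rcases h1 : cell P p (perm p c) with _ | G <;> rcases h2 : cell P p (perm p c') with _ | G' <;>
    rw [h1, h2] at h <;> simp at h
  · exact h
  · subst h
    exact (perm p).injective (cell_injective h1 h2)

theorem nodeLabel_ne_fresh (perm : P.Node → Equiv.Perm (Fin P.m)) (p : P.Node) (c c' : Fin P.m)
    (r : Fin N) : nodeLabel perm p c ≠ .fresh r c' := by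
  unfold nodeLabel
  cases cell P p (perm p c) <;> simp

/-- A node that may be corrupted has no group in `D`, so it is not `i` and does not hold the hidden
fillers either. -/
theorem not_hidden_nodeLabel (hi : ∃ G ∈ D, G ∈ P.groups i)
    (perm : P.Node → Equiv.Perm (Fin P.m)) {p : P.Node} (hp : Disjoint (P.groups p) D)
    (c : Fin P.m) : ¬ Hidden i D (nodeLabel (N := N) perm p c) := by
  unfold nodeLabel
  rcases h : cell P p (perm p c) with _ | G
  · rintro rfl
    obtain ⟨G, hG, hG'⟩ := hi
    exact Finset.disjoint_left.1 hp hG' hG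
  · exact Finset.disjoint_left.1 hp (mem_groups_of_cell h)

theorem sharesHidden_of_nodeLabel_eq (hi : ∃ G ∈ D, G ∈ P.groups i)
    (perm : P.Node → Equiv.Perm (Fin P.m)) {p : P.Node} {c c' : Fin P.m}
    (hh : Hidden i D (nodeLabel (N := N) perm i c))
    (h : nodeLabel (N := N) perm i c = nodeLabel perm p c') : SharesHidden i D (.node p) := by
  unfold nodeLabel at h hh
  rcases h1 : cell P i (perm i c) with _ | G <;> rcases h2 : cell P p (perm p c') with _ | G' <;>
    rw [h1, h2] at h <;> rw [h1] at hh <;> simp at h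
  · obtain ⟨rfl, -⟩ := h
    obtain ⟨G, hG, hG'⟩ := hi
    exact ⟨G, hG, hG', hG'⟩
  · subst h
    exact ⟨G, hh, mem_groups_of_cell h1, mem_groups_of_cell h2⟩

/-- In a cell of the target that holds no hidden secret, the simulator and `i` use the same secret;
the others hold a hidden secret of `i` or a fresh value of the simulator. -/
theorem symb_target (val : Label P N → P.Secret) (perm : P.Node → Equiv.Perm (Fin P.m))
    (r : Fin N) (c : Fin P.m) :
    (∃ s, ∀ sim, symb i D val (label i D sim perm r .target c) = .inl s) ∨
    (Hidden i D (nodeLabel (N := N) perm i c) ∧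
      symb i D val (label i D false perm r .target c) = .inr (nodeLabel perm i c) ∧
      symb i D val (label i D true perm r .target c) = .inr (.fresh r c)) := by
  have hf : Hidden i D (.fresh r c) := trivial
  rcases h : cell P i (perm i c) with _ | G
  · have hn : nodeLabel (N := N) perm i c = .filler i (perm i c) := by simp [nodeLabel, h]
    have hs : simLabel (N := N) i D perm r c = .fresh r c := by simp [simLabel, h]
    have hh : Hidden (N := N) i D (.filler i (perm i c)) := rfl
    exact Or.inr (by simp [label, hn, hs, symb, hf, hh])
  · have hn : nodeLabel (N := N) perm i c = .grp G := by simp [nodeLabel, h]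
    by_cases hG : G ∈ D
    · have hs : simLabel (N := N) i D perm r c = .fresh r c := by simp [simLabel, h, hG]
      have hh : Hidden (N := N) i D (.grp G) := hG
      exact Or.inr (by simp [label, hn, hs, symb, hf, hh])
    · have hs : simLabel (N := N) i D perm r c = .grp G := by simp [simLabel, h, hG]
      have hh : ¬ Hidden (N := N) i D (.grp G) := hG
      exact Or.inl ⟨val (.grp G), by simp [label, hn, hs, symb, hh]⟩

/-- A run with the target and another run, in the same role and with a participant that shares a
hidden group with the target, have the same session key. -/
def KeyMatch (i : P.Node) (D : Finset P.Grp) (b : Base P N)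
    (S : Fin N → Option (Session P)) : Prop :=
  ∃ (r r' : Fin N) (w : Party P) (ρ : Role) (u u' : P.Elem), r ≠ r' ∧
    S r = some ⟨.target, ρ, some u⟩ ∧ S r' = some ⟨w, ρ, some u'⟩ ∧ SharesHidden i D w ∧
    b.kdf (u ^ b.exp r) = b.kdf (u' ^ b.exp r')

/-- A hidden cell of the target carries a name of `i` or a fresh name. Against a node, the fresh
name never matches, and a match of the name of `i` would be a `KeyMatch`. Against the target, only
the same run is possible without a `KeyMatch`, and there both namings are injective in the cell. -/
theorem symb_label_pattern (hi : ∃ G ∈ D, G ∈ P.groups i) (b : Base P N)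
    {S : Fin N → Option (Session P)} (hS : ¬ KeyMatch i D b S) {r r' : Fin N} {w' : Party P}
    {ρ : Role} {u u' : P.Elem} (h : S r = some ⟨.target, ρ, some u⟩)
    (h' : S r' = some ⟨w', ρ, some u'⟩) (hk : b.kdf (u ^ b.exp r) = b.kdf (u' ^ b.exp r'))
    (c c' : Fin P.m) :
    symb i D b.val (label i D false b.perm r .target c) =
      symb i D b.val (label i D false b.perm r' w' c') ↔
    symb i D b.val (label i D true b.perm r .target c) =
      symb i D b.val (label i D true b.perm r' w' c') := by
  cases w' with
  | node p =>
    have e : label i D true b.perm r' (.node p) c' = nodeLabel b.perm p c' := rfl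
    have e' : label i D false b.perm r' (.node p) c' = nodeLabel b.perm p c' := rfl
    rw [e, e']
    rcases symb_target (i := i) (D := D) b.val b.perm r c with ⟨s, hs⟩ | ⟨hh, h1, h2⟩
    · rw [hs, hs]
    · rw [h1, h2]
      refine iff_of_false (fun he => hS ?_) fun he =>
        nodeLabel_ne_fresh b.perm p c' c r (symb_eq_inr he.symm).1
      refine ⟨r, r', .node p, ρ, u, u', ?_, h, h',
        sharesHidden_of_nodeLabel_eq hi b.perm hh (symb_eq_inr he.symm).1.symm, hk⟩
      rintro rfl
      rw [h] at h'
      simp at h'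
  | target =>
    have hr : r = r' := by
      by_contra hr
      exact hS ⟨r, r', .target, ρ, u, u', hr, h, h', trivial, hk⟩
    subst hr
    rcases symb_target (i := i) (D := D) b.val b.perm r c with ⟨s, hs⟩ | ⟨-, h1, h2⟩ <;>
      rcases symb_target (i := i) (D := D) b.val b.perm r c' with ⟨s', hs'⟩ | ⟨-, h1', h2'⟩
    · rw [hs, hs, hs', hs']
    · rw [hs, hs, h1', h2']; simp
    · rw [hs', hs', h1, h2]; simp
    · rw [h1, h2, h1', h2']
      simp only [Sum.inr.injEq, Label.fresh.injEq, true_and]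
      exact (nodeLabel_injective b.perm i).eq_iff

theorem inl_eq_symb_pattern (b : Base P N) (s : P.Secret) (r : Fin N) (w : Party P)
    (c : Fin P.m) :
    .inl s = symb i D b.val (label i D false b.perm r w c) ↔
      .inl s = symb i D b.val (label i D true b.perm r w c) := by
  cases w with
  | node p => rfl
  | target =>
    rcases symb_target (i := i) (D := D) b.val b.perm r c with ⟨s, hs⟩ | ⟨-, h1, h2⟩
    · rw [hs, hs]
    · rw [h1, h2]; simp

theorem point_pattern (hi : ∃ G ∈ D, G ∈ P.groups i) (b : Base P N)
    {S : Fin N → Option (Session P)} (hS : ¬ KeyMatch i D b S) {Q Q' : Query P N}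
    (hQ : ∀ r w ρ u, Q = .hash r w ρ u → S r = some ⟨w, ρ, some u⟩)
    (hQ' : ∀ r w ρ u, Q' = .hash r w ρ u → S r = some ⟨w, ρ, some u⟩) (c c' : Fin P.m) :
    point i D false b Q c = point i D false b Q' c' ↔
      point i D true b Q c = point i D true b Q' c' := by
  rcases Q with ⟨r, w, ρ, u⟩ | ⟨ρ, k, s⟩ <;> rcases Q' with ⟨r', w', ρ', u'⟩ | ⟨ρ', k', s'⟩ <;>
    simp only [point, Prod.mk.injEq]
  · refine and_congr_right fun hρ => and_congr_right fun hk => ?_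
    subst hρ
    have h := hQ _ _ _ _ rfl
    have h' := hQ' _ _ _ _ rfl
    cases w with
    | target => exact symb_label_pattern hi b hS h h' hk c c'
    | node p =>
      cases w' with
      | target =>
        -- The pattern lemma wants the target on the left, so the equations are reversed.
        rw [eq_comm, symb_label_pattern hi b hS h' h hk.symm c' c, eq_comm]
      | node p' => rfl
  · rw [eq_comm (b := Sum.inl s'), eq_comm (b := Sum.inl s'), inl_eq_symb_pattern]
  · rw [inl_eq_symb_pattern]

end Labels

/-! ### Exchanging hidden secrets for their names. -/

section Games

variable {P : Setup} (hm : 0 < P.m) (i : P.Node) (D : Finset P.Grp) (sim : Bool)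
  (A : Adversary P)

/-- The probability of an event, depending on the answers of the keyed hash functions, in the
execution of the protocol. -/
noncomputable def realProb
    (E : Base P A.rounds × A.Tape → (Fin A.rounds → Fin P.m → P.Digest) → Prop) : ℝ :=
  prob fun x : (Base P A.rounds × A.Tape) × (Role × P.Key × P.Secret → P.Digest) =>
    E x.1 (answers start (round hm D A x.1.1 x.1.2) (realPoint i D sim A x.1.1 x.1.2) x.2)

/-- The probability of an event if hidden secrets are replaced by their names in the
arguments of the keyed hash functions. -/
noncomputable def symProb
    (E : Base P A.rounds × A.Tape → (Fin A.rounds → Fin P.m → P.Digest) → Prop) : ℝ :=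
  prob fun x : (Base P A.rounds × A.Tape) ×
      (Role × P.Key × (P.Secret ⊕ Label P A.rounds) → P.Digest) =>
    E x.1 (answers start (round hm D A x.1.1 x.1.2) (symPoint i D sim A x.1.1 x.1.2) x.2)

theorem symProb_false_eq_true (hi : ∃ G ∈ D, G ∈ P.groups i)
    (E : Base P A.rounds × A.Tape → (Fin A.rounds → Fin P.m → P.Digest) → Prop) :
    symProb hm i D false A (fun x a => E x a ∧
        ¬ KeyMatch i D x.1 (stateAt hm D A x.1 x.2 a A.rounds).sessions) =
      symProb hm i D true A (fun x a => E x a ∧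
        ¬ KeyMatch i D x.1 (stateAt hm D A x.1 x.2 a A.rounds).sessions) := by
  refine prob_answers_prod_eq (B := Base P A.rounds × A.Tape) start
    (fun x => round hm D A x.1 x.2) (fun x => symPoint i D false A x.1 x.2)
    (fun x => symPoint i D true A x.1 x.2) (fun x a => E x a ∧
        ¬ KeyMatch i D x.1 (stateAt hm D A x.1 x.2 a A.rounds).sessions) ?_
  rintro x a ⟨-, ha⟩ p p'
  exact point_pattern hi x.1 ha
    (fun r w ρ u h => session_of_query hm D A x.1 x.2 a h)
    (fun r w ρ u h => session_of_query hm D A x.1 x.2 a h) p.2 p'.2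

/-- The name of the secret at position `p` of the queries to the keyed hash functions. -/
noncomputable def symSecret
    (x : (Base P A.rounds × A.Tape) × (Role × P.Key × (P.Secret ⊕ Label P A.rounds) → P.Digest))
    (p : Fin A.rounds × Fin P.m) : P.Secret ⊕ Label P A.rounds :=
  (symPoint i D sim A x.1.1 x.1.2 p.1
    (run start (round hm D A x.1.1 x.1.2) (symPoint i D sim A x.1.1 x.1.2) x.2 p.1) p.2).2.2

open Classical in
/-- Replace a named secret. -/
noncomputable def setVal {N : ℕ} (b : Base P N) (ℓ : P.Secret ⊕ Label P N) (s : P.Secret) :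
    Base P N :=
  match ℓ with
  | .inl _ => b
  | .inr ℓ => { b with val := Function.update b.val ℓ s }

open Classical in
theorem symb_update {N : ℕ} {i : P.Node} {D : Finset P.Grp} (b : Base P N) {ℓ : Label P N}
    (hℓ : Hidden i D ℓ) (s : P.Secret) (ℓ' : Label P N) :
    symb i D (setVal b (.inr ℓ) s).val ℓ' = symb i D b.val ℓ' := by
  unfold symb
  split_ifs with h
  · rfl
  · have : ℓ' ≠ ℓ := fun e => h (e ▸ hℓ)
    simp [setVal, Function.update_of_ne this]

-- Among the transitions only corruption reads `val`, and it reads no hidden name.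
open Classical in
theorem round_setVal {i : P.Node} {D : Finset P.Grp} (hi : ∃ G ∈ D, G ∈ P.groups i)
    (b : Base P A.rounds) {ℓ : Label P A.rounds} (hℓ : Hidden i D ℓ) (s : P.Secret) :
    round hm D A (setVal b (.inr ℓ) s) = round hm D A b := by
  have key : ∀ t S a act, advance hm D (setVal b (.inr ℓ) s) t S a act =
      advance hm D b t S a act := by
    intro t S a act
    cases act with
    | corrupt p =>
      simp only [advance]
      split_ifs with hp
      · congr 2
        funext c
        have : nodeLabel b.perm p c ≠ ℓ := fun e =>
          not_hidden_nodeLabel hi b.perm hp c (e ▸ hℓ)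
        simp [setVal, Function.update_of_ne this]
      · rfl
    | _ => rfl
  funext τ t S a
  simp only [round, key]

theorem symPoint_setVal {i : P.Node} {D : Finset P.Grp} (b : Base P A.rounds)
    {ℓ : Label P A.rounds} (hℓ : Hidden i D ℓ) (s : P.Secret) :
    symPoint i D sim A (setVal b (.inr ℓ) s) = symPoint i D sim A b := by
  have key : ∀ Q c, point i D sim (setVal b (.inr ℓ) s) Q c = point i D sim b Q c := by
    intro Q c
    cases Q with
    | plain ρ k s => rfl
    | hash r w ρ u =>
      simp only [point, symb_update b hℓ]
      rfl
  funext τ t S c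
  simp only [symPoint, key]

theorem hidden_of_symSecret {i : P.Node} {D : Finset P.Grp}
    {x : (Base P A.rounds × A.Tape) ×
      (Role × P.Key × (P.Secret ⊕ Label P A.rounds) → P.Digest)}
    {p : Fin A.rounds × Fin P.m} {ℓ : Label P A.rounds}
    (h : symSecret hm i D sim A x p = .inr ℓ) : Hidden i D ℓ := by
  unfold symSecret symPoint at h
  generalize query _ _ = Q at h
  cases Q with
  | plain ρ k s => simp [point] at h
  | hash r w ρ u =>
    obtain ⟨rfl, hh⟩ := symb_eq_inr h
    exact hh

theorem symSecret_setVal {i : P.Node} {D : Finset P.Grp} (hi : ∃ G ∈ D, G ∈ P.groups i)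
    (b : Base P A.rounds) (τ : A.Tape)
    (f : Role × P.Key × (P.Secret ⊕ Label P A.rounds) → P.Digest)
    {ℓ : Label P A.rounds} (hℓ : Hidden i D ℓ) (s : P.Secret) (p : Fin A.rounds × Fin P.m) :
    symSecret hm i D sim A ((setVal b (.inr ℓ) s, τ), f) p =
      symSecret hm i D sim A ((b, τ), f) p := by
  simp only [symSecret, round_setVal hm A hi b hℓ, symPoint_setVal sim A b hℓ]

/-- Different names of secrets in the queries are unlikely to denote the same secret. -/
theorem prob_secret_collision_le (hi : ∃ G ∈ D, G ∈ P.groups i) :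
    prob (fun x : (Base P A.rounds × A.Tape) ×
        (Role × P.Key × (P.Secret ⊕ Label P A.rounds) → P.Digest) =>
      ∃ p : (Fin A.rounds × Fin P.m) × (Fin A.rounds × Fin P.m),
        symSecret hm i D sim A x p.1 ≠ symSecret hm i D sim A x p.2 ∧
        Sum.elim id x.1.1.val (symSecret hm i D sim A x p.1) =
          Sum.elim id x.1.1.val (symSecret hm i D sim A x p.2)) ≤
      (A.rounds * P.m : ℝ) ^ 2 / Nat.card P.Secret := by
  classical
  -- Two distinct plain secrets cannot have equal values, so one entry is a name. Swapping the pair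
  -- puts it first, where its value can be resampled.
  refine (prob_mono (F := fun x => ∃ p : (Fin A.rounds × Fin P.m) × (Fin A.rounds × Fin P.m),
    (symSecret hm i D sim A x p.1).isRight ∧
    symSecret hm i D sim A x p.1 ≠ symSecret hm i D sim A x p.2 ∧
        Sum.elim id x.1.1.val (symSecret hm i D sim A x p.1) =
          Sum.elim id x.1.1.val (symSecret hm i D sim A x p.2)) ?_).trans
    ((prob_exists_le _).trans ?_)
  · rintro x ⟨p, hne, heq⟩
    rcases h1 : symSecret hm i D sim A x p.1 with s | ℓ
    · rcases h2 : symSecret hm i D sim A x p.2 with s' | ℓ'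
      · rw [h1, h2] at hne heq
        exact absurd (congrArg Sum.inl heq) hne
      · exact ⟨(p.2, p.1), by simp [h2], hne.symm, heq.symm⟩
    · exact ⟨p, by simp [h1], hne, heq⟩
  refine (Finset.sum_le_sum fun p _ => prob_le_of_resample (V := P.Secret) _
    (fun x => Sum.elim id x.1.1.val (symSecret hm i D sim A x p.1))
    (fun x s => ((setVal x.1.1 (symSecret hm i D sim A x p.1) s, x.1.2), x.2))
    ?_ ?_ ?_ ?_).trans ?_
  · rintro ⟨⟨b, τ⟩, f⟩ s ⟨hr, -⟩
    obtain ⟨ℓ, hℓ⟩ := Sum.isRight_iff.1 hr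
    have hh := hidden_of_symSecret hm sim A hℓ
    have key : symSecret hm i D sim A ((setVal b (.inr ℓ) s, τ), f) p.1 = .inr ℓ :=
      (symSecret_setVal hm sim A hi b τ f hh s p.1).trans hℓ
    simp only [hℓ, key]
    simp [setVal]
  · rintro ⟨⟨b, τ⟩, f⟩ ⟨hr, -⟩
    obtain ⟨ℓ, hℓ⟩ := Sum.isRight_iff.1 hr
    simp only [hℓ]
    simp [setVal]
  · rintro ⟨⟨b, τ⟩, f⟩ s s' ⟨hr, -⟩
    obtain ⟨ℓ, hℓ⟩ := Sum.isRight_iff.1 hr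
    have hh := hidden_of_symSecret hm sim A hℓ
    have key : symSecret hm i D sim A ((setVal b (.inr ℓ) s, τ), f) p.1 = .inr ℓ :=
      (symSecret_setVal hm sim A hi b τ f hh s p.1).trans hℓ
    simp only [hℓ, key]
    simp [setVal]
  -- Resampling changes neither the names nor the value of the other entry, which has a different
  -- name or none. That value is the only one giving a collision.
  · rintro ⟨⟨b, τ⟩, f⟩ s ⟨hr, hne, heq⟩ ⟨-, -, heq'⟩
    obtain ⟨ℓ, hℓ⟩ := Sum.isRight_iff.1 hr
    have hh := hidden_of_symSecret hm sim A hℓ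
    simp only [hℓ] at heq' hne heq ⊢
    rw [symSecret_setVal hm sim A hi b τ f hh, symSecret_setVal hm sim A hi b τ f hh, hℓ] at heq'
    rw [heq]
    rcases h2 : symSecret hm i D sim A ((b, τ), f) p.2 with s' | ℓ'
    · rw [h2] at heq'
      simpa [setVal] using heq'.symm
    · rw [h2] at heq' hne
      have : ℓ' ≠ ℓ := fun e => hne (by rw [e])
      simpa [setVal, Function.update_of_ne this] using heq'.symm
  · simp only [Finset.sum_const, Finset.card_univ, Fintype.card_prod, Fintype.card_fin,
      nsmul_eq_mul]
    push_cast
    apply le_of_eq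
    ring

/-- Replacing hidden secrets by their names is hardly noticeable. -/
theorem abs_realProb_sub_symProb_le (hi : ∃ G ∈ D, G ∈ P.groups i)
    (E : Base P A.rounds × A.Tape → (Fin A.rounds → Fin P.m → P.Digest) → Prop) :
    |realProb hm i D sim A E - symProb hm i D sim A E| ≤
      (A.rounds * P.m : ℝ) ^ 2 / Nat.card P.Secret := by
  set δ := (A.rounds * P.m : ℝ) ^ 2 / Nat.card P.Secret with hδ
  let pt (x : Base P A.rounds × A.Tape) (a : Fin A.rounds → Fin P.m → P.Digest)
      (p : Fin A.rounds × Fin P.m) :=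
    symPoint i D sim A x.1 x.2 p.1 (stateAt hm D A x.1 x.2 a p.1) p.2
  let Gen (x : Base P A.rounds × A.Tape) (a : Fin A.rounds → Fin P.m → P.Digest) : Prop :=
    ∀ p p', Sum.elim id x.1.val (pt x a p).2.2 = Sum.elim id x.1.val (pt x a p').2.2 →
      (pt x a p).2.2 = (pt x a p').2.2
  have hGen : symProb hm i D sim A (fun x a => ¬ Gen x a) ≤ δ := by
    refine le_trans (prob_mono ?_) (prob_secret_collision_le hm i D sim A hi)
    intro x hx
    simp only [Gen, not_forall, pt, stateAt, traj_answers] at hx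
    obtain ⟨p, p', h1, h2⟩ := hx
    exact ⟨(p, p'), h2, h1⟩
  -- Bounding the failure of `Gen` in the symbolic game suffices: this one-sided estimate, applied
  -- to `E` and to its complement, gives both directions.
  have hle : ∀ E : Base P A.rounds × A.Tape → (Fin A.rounds → Fin P.m → P.Digest) → Prop,
      symProb hm i D sim A E - δ ≤ realProb hm i D sim A E := by
    intro E
    have h1 : realProb hm i D sim A (fun x a => E x a ∧ Gen x a) =
        symProb hm i D sim A (fun x a => E x a ∧ Gen x a) := by
      refine prob_answers_prod_eq (B := Base P A.rounds × A.Tape) start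
        (fun x => round hm D A x.1 x.2) (fun x => realPoint i D sim A x.1 x.2)
        (fun x => symPoint i D sim A x.1 x.2) (fun x a => E x a ∧ Gen x a) ?_
      rintro x a ⟨-, ha⟩ p p'
      simp only [realPoint, Prod.mk.injEq]
      rw [Prod.ext_iff, Prod.ext_iff]
      refine and_congr_right fun _ => and_congr_right fun _ => ⟨ha p p', fun h => ?_⟩
      rw [h]
    have h2 : symProb hm i D sim A (fun x a => E x a ∧ Gen x a) +
        symProb hm i D sim A (fun x a => E x a ∧ ¬ Gen x a) = symProb hm i D sim A E :=
      prob_and_add_and_not _ _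
    have h3 : symProb hm i D sim A (fun x a => E x a ∧ ¬ Gen x a) ≤
        symProb hm i D sim A (fun x a => ¬ Gen x a) := prob_mono fun x h => h.2
    have h4 : realProb hm i D sim A (fun x a => E x a ∧ Gen x a) ≤ realProb hm i D sim A E :=
      prob_mono fun x h => h.1
    linarith
  have h1 := hle E
  have h2 := hle fun x a => ¬ E x a
  have h3 : realProb hm i D sim A (fun x a => ¬ E x a) = 1 - realProb hm i D sim A E :=
    prob_not _
  have h4 : symProb hm i D sim A (fun x a => ¬ E x a) = 1 - symProb hm i D sim A E :=
    prob_not _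
  rw [abs_le]
  constructor <;> linarith

end Games

/-! ### Resampling keys and exponents. -/

section Resampling

variable {P : Setup} (hm : 0 < P.m) (i : P.Node) (D : Finset P.Grp) (sim : Bool)
  (A : Adversary P)

theorem advance_congr {N : ℕ} {b b' : Base P N} (hperm : b'.perm = b.perm) (hval : b'.val = b.val)
    {t : Fin N} {S : Fin N → Option (Session P)} {act : Action P N} (hexp : b'.exp t = b.exp t)
    (hS : ∀ r w ρ u, S r = some ⟨w, ρ, some u⟩ →
      b'.kdf (u ^ b'.exp r) = b.kdf (u ^ b.exp r))
    (hkdf : ∀ z, act = .kdf z → b'.kdf z = b.kdf z) (a : Fin P.m → P.Digest) :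
    advance hm D b' t S a act = advance hm D b t S a act := by
  cases act with
  | reveal r =>
    simp only [advance]
    rcases h : S r with _ | ⟨w, ρ, _ | v⟩
    · rfl
    · rfl
    · simp only
      rw [hS _ _ _ _ h]
  | kdf z => simp only [advance, hkdf z rfl]
  | initiate w => simp only [advance, hexp]
  | respond w v => simp only [advance, hexp]
  | corrupt p => simp only [advance, hperm, hval]
  | _ => rfl

theorem point_congr {N : ℕ} {b b' : Base P N} (hperm : b'.perm = b.perm) (hval : b'.val = b.val)
    {S : Fin N → Option (Session P)} {act : Action P N}
    (hS : ∀ r w ρ u, S r = some ⟨w, ρ, some u⟩ →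
      b'.kdf (u ^ b'.exp r) = b.kdf (u ^ b.exp r))
    (hx : ∀ r w u, act = .exchange r u → S r = some ⟨w, .initiator, none⟩ →
      b'.kdf (u ^ b'.exp r) = b.kdf (u ^ b.exp r)) :
    point i D sim b' (query S act) = point i D sim b (query S act) := by
  cases act with
  | exchange r u =>
    simp only [query]
    rcases h : S r with _ | ⟨w, _ | _, _ | v⟩
    case exchange.some.initiator.none =>
      simp only
      split_ifs
      · rfl
      · funext c
        simp only [point, hperm, hval, hx r w u rfl h]
    all_goals rfl
  | membership r H =>
    simp only [query]
    rcases h : S r with _ | ⟨w, _ | _, _ | v⟩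
    case membership.some.responder.some =>
      funext c
      simp only [point, hperm, hval, hS _ _ _ _ h]
    all_goals rfl
  | _ => rfl

/-- The state after `n` rounds of the execution with named secrets. -/
noncomputable def symState (b : Base P A.rounds) (τ : A.Tape)
    (f : Role × P.Key × (P.Secret ⊕ Label P A.rounds) → P.Digest) (n : ℕ) : State P A.rounds :=
  run start (round hm D A b τ) (symPoint i D sim A b τ) f n

/-- The action in round `t` of the execution with named secrets. -/
noncomputable def symAction (b : Base P A.rounds) (τ : A.Tape)
    (f : Role × P.Key × (P.Secret ⊕ Label P A.rounds) → P.Digest) (t : Fin A.rounds) :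
    Action P A.rounds :=
  A.move τ (symState hm i D sim A b τ f t).replies

variable (b b' : Base P A.rounds) (τ : A.Tape)
  (f : Role × P.Key × (P.Secret ⊕ Label P A.rounds) → P.Digest)

theorem stateAt_answers (n : ℕ) :
    stateAt hm D A b τ (answers start (round hm D A b τ) (symPoint i D sim A b τ) f) n =
      symState hm i D sim A b τ f n :=
  traj_answers _ _ _ _ _

theorem actionAt_answers (t : Fin A.rounds) :
    actionAt hm D A b τ (answers start (round hm D A b τ) (symPoint i D sim A b τ) f) t =
      symAction hm i D sim A b τ f t := by
  unfold actionAt symAction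
  rw [stateAt_answers]

-- Common criterion for both resamplings: the execution cannot notice a change of `kdf` or of the
-- exponents at places it has not evaluated.
variable {b b'} in
theorem symState_congr (hperm : b'.perm = b.perm) (hval : b'.val = b.val) (n : ℕ)
    (hn : n ≤ A.rounds)
    (h : ∀ t : Fin A.rounds, (t : ℕ) < n → b'.exp t = b.exp t ∧
      (∀ r w ρ u, (symState hm i D sim A b τ f t).sessions r = some ⟨w, ρ, some u⟩ →
        b'.kdf (u ^ b'.exp r) = b.kdf (u ^ b.exp r)) ∧
      (∀ z, symAction hm i D sim A b τ f t = .kdf z → b'.kdf z = b.kdf z) ∧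
      (∀ r w u, symAction hm i D sim A b τ f t = .exchange r u →
        (symState hm i D sim A b τ f t).sessions r = some ⟨w, .initiator, none⟩ →
        b'.kdf (u ^ b'.exp r) = b.kdf (u ^ b.exp r))) :
    symState hm i D sim A b' τ f n = symState hm i D sim A b τ f n := by
  induction n with
  | zero => rfl
  | succ n ih =>
    have ih := ih (Nat.le_of_succ_le hn) fun t ht => h t (Nat.lt_succ_of_lt ht)
    obtain ⟨h1, h2, h3, h4⟩ := h ⟨n, hn⟩ (Nat.lt_succ_self n)
    have hlt : n < A.rounds := hn
    simp only [symAction] at h3 h4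
    unfold symState at ih h2 h3 h4 ⊢
    simp only [run, hlt, dif_pos]
    rw [ih]
    have hp : symPoint i D sim A b' τ ⟨n, hlt⟩
          (run start (round hm D A b τ) (symPoint i D sim A b τ) f n) =
        symPoint i D sim A b τ ⟨n, hlt⟩
          (run start (round hm D A b τ) (symPoint i D sim A b τ) f n) :=
      point_congr i D sim hperm hval h2 h4
    rw [hp]
    simp only at h2
    generalize run start (round hm D A b τ) (symPoint i D sim A b τ) f n = s at *
    simp only [round]
    rw [advance_congr hm D hperm hval h1 h2 h3]

/-- The point of `kdf` touched in round `t` of the execution with named secrets. -/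
noncomputable def symTouch (t : Fin A.rounds) : P.Elem :=
  touch b t (symAction hm i D sim A b τ f t)

open Classical in
/-- Replace one value of `kdf`. -/
noncomputable def setKdf {N : ℕ} (b : Base P N) (z : P.Elem) (k : P.Key) : Base P N :=
  { b with kdf := Function.update b.kdf z k }

theorem touch_symState {n : ℕ} (hn : n ≤ A.rounds) {r : Fin A.rounds} {w : Party P} {ρ : Role}
    {u : P.Elem}
    (h : (symState hm i D sim A b τ f n).sessions r = some ⟨w, ρ, some u⟩) :
    ∃ j : Fin A.rounds, (j : ℕ) < n ∧ symTouch hm i D sim A b τ f j = u ^ b.exp r := by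
  rw [← stateAt_answers] at h
  obtain ⟨j, hj, e⟩ := touch_of_session hm D A b τ _ hn h
  rw [actionAt_answers] at e
  exact ⟨j, hj, e⟩

/-- Every key used before round `t` is the value of `kdf` at a point touched before `t`, so
reprogramming a point not yet touched leaves the actions up to round `t` unchanged. -/
theorem symTouch_setKdf {t : Fin A.rounds} {z : P.Elem}
    (hz : ∀ j < t, symTouch hm i D sim A b τ f j ≠ z) (k : P.Key) {j : Fin A.rounds}
    (hj : j ≤ t) :
    symTouch hm i D sim A (setKdf b z k) τ f j = symTouch hm i D sim A b τ f j := by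
  have hs : symState hm i D sim A (setKdf b z k) τ f j = symState hm i D sim A b τ f j := by
    have hne : ∀ z', z' ≠ z → (setKdf b z k).kdf z' = b.kdf z' := fun z' h => by
      simp [setKdf, h]
    refine symState_congr (b := b) (b' := setKdf b z k) hm i D sim A τ f rfl rfl j j.2.le fun n hn => ⟨rfl, ?_, ?_, ?_⟩
    · intro r w ρ u h
      obtain ⟨j', hj', e⟩ := touch_symState hm i D sim A b τ f n.2.le h
      exact hne _ (e ▸ hz j' (hj'.trans (hn.trans_le hj)))
    · intro z' h
      refine hne _ ?_
      have := hz n (hn.trans_le hj)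
      rwa [symTouch, h] at this
    · intro r w u h _
      refine hne _ ?_
      have := hz n (hn.trans_le hj)
      rwa [symTouch, h] at this
  have ha : symAction hm i D sim A (setKdf b z k) τ f j = symAction hm i D sim A b τ f j := by
    unfold symAction
    rw [hs]
  unfold symTouch
  rw [ha]
  generalize symAction hm i D sim A b τ f j = act
  cases act <;> rfl

/-- A collision of `kdf` between a new point and an earlier one is unlikely. -/
theorem prob_kdf_collision_le (t j : Fin A.rounds) :
    prob (fun x : (Base P A.rounds × A.Tape) ×
        (Role × P.Key × (P.Secret ⊕ Label P A.rounds) → P.Digest) =>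
      j < t ∧ (∀ j' < t, symTouch hm i D sim A x.1.1 x.1.2 x.2 j' ≠
        symTouch hm i D sim A x.1.1 x.1.2 x.2 t) ∧
      x.1.1.kdf (symTouch hm i D sim A x.1.1 x.1.2 x.2 t) =
        x.1.1.kdf (symTouch hm i D sim A x.1.1 x.1.2 x.2 j)) ≤ 1 / Nat.card P.Key := by
  refine prob_le_of_resample (V := P.Key) _
    (fun x => x.1.1.kdf (symTouch hm i D sim A x.1.1 x.1.2 x.2 t))
    (fun x k => ((setKdf x.1.1 (symTouch hm i D sim A x.1.1 x.1.2 x.2 t) k, x.1.2), x.2))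
    ?_ ?_ ?_ ?_
  · rintro ⟨⟨b, τ⟩, f⟩ k ⟨-, hz, -⟩
    simp only at hz ⊢
    rw [symTouch_setKdf hm i D sim A b τ f hz k le_rfl]
    simp [setKdf]
  · rintro ⟨⟨b, τ⟩, f⟩ -
    simp [setKdf]
  · rintro ⟨⟨b, τ⟩, f⟩ k k' ⟨-, hz, -⟩
    simp only at hz ⊢
    rw [symTouch_setKdf hm i D sim A b τ f hz k le_rfl]
    simp [setKdf]
  · rintro ⟨⟨b, τ⟩, f⟩ k ⟨hj, hz, heq⟩ ⟨-, -, heq'⟩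
    simp only at hz heq heq' ⊢
    rw [symTouch_setKdf hm i D sim A b τ f hz k le_rfl,
      symTouch_setKdf hm i D sim A b τ f hz k hj.le] at heq'
    rw [heq]
    simpa [setKdf, hz j hj] using heq'.symm

/-- Replace one secret exponent. -/
def setExpo {N : ℕ} (b : Base P N) (t : Fin N) (y : Fin (Nat.card P.Elem - 1)) : Base P N :=
  { b with expo := Function.update b.expo t y }

/-- The exponent of round `t` first enters in the reply of that round, after the action has been
chosen. -/
theorem symAction_setExpo (t : Fin A.rounds) (y : Fin (Nat.card P.Elem - 1)) {j : Fin A.rounds}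
    (hj : j ≤ t) :
    symAction hm i D sim A (setExpo b t y) τ f j = symAction hm i D sim A b τ f j := by
  have hs : symState hm i D sim A (setExpo b t y) τ f j = symState hm i D sim A b τ f j := by
    have hne : ∀ r, r ≠ t → (setExpo b t y).exp r = b.exp r := fun r h => by
      simp [setExpo, Base.exp, Function.update_of_ne h]
    have hlt : ∀ n r : Fin A.rounds, n < j → ∀ s,
        (symState hm i D sim A b τ f n).sessions r = some s → r ≠ t := by
      rintro n r hn s h rfl
      rw [← stateAt_answers] at h
      exact absurd ((lt_of_session hm D A b τ _ n.2.le h).trans (hn.trans_le hj)) (lt_irrefl _)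
    refine symState_congr (b := b) (b' := setExpo b t y) hm i D sim A τ f rfl rfl j j.2.le
      fun n hn => ⟨?_, ?_, ?_, ?_⟩
    · exact hne n (ne_of_lt (hn.trans_le hj))
    · intro r w ρ u h
      rw [hne r (hlt n r hn _ h)]
      rfl
    · intro z _
      rfl
    · intro r w u _ h
      rw [hne r (hlt n r hn _ h)]
      rfl
  unfold symAction
  rw [hs]

theorem pow_exponent_injective {v : P.Elem} (hv : v ≠ 1) {y y' : Fin (Nat.card P.Elem - 1)}
    (h : v ^ ((y : ℕ) + 1) = v ^ ((y' : ℕ) + 1)) : y = y' := by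
  have ho : orderOf v = Nat.card P.Elem :=
    ((Nat.dvd_prime P.card_prime).1 (orderOf_dvd_natCard v)).resolve_left
      (by rwa [orderOf_eq_one_iff])
  have := pow_injOn_Iio_orderOf (x := v) (x₁ := (y : ℕ) + 1) (x₂ := (y' : ℕ) + 1)
    (by rw [ho]; simp only [Set.mem_Iio]; omega) (by rw [ho]; simp only [Set.mem_Iio]; omega) h
  exact Fin.ext (by omega)

/-- The Diffie-Hellman values of two responders are unlikely to be equal. -/
theorem prob_responder_collision_le (t j : Fin A.rounds) :
    prob (fun x : (Base P A.rounds × A.Tape) ×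
        (Role × P.Key × (P.Secret ⊕ Label P A.rounds) → P.Digest) =>
      j < t ∧ ∃ w v w' v', symAction hm i D sim A x.1.1 x.1.2 x.2 j = .respond w v ∧
        symAction hm i D sim A x.1.1 x.1.2 x.2 t = .respond w' v' ∧ v' ≠ 1 ∧
        v ^ x.1.1.exp j = v' ^ x.1.1.exp t) ≤ 1 / (Nat.card P.Elem - 1 : ℕ) := by
  have h2 := P.card_prime.two_le
  have : Nonempty (Fin (Nat.card P.Elem - 1)) := ⟨⟨0, by omega⟩⟩
  rw [show Nat.card P.Elem - 1 = Nat.card (Fin (Nat.card P.Elem - 1)) by simp]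
  refine prob_le_of_resample (V := Fin (Nat.card P.Elem - 1)) _ (fun x => x.1.1.expo t)
    (fun x y => ((setExpo x.1.1 t y, x.1.2), x.2)) ?_ ?_ ?_ ?_
  · rintro ⟨⟨b, τ⟩, f⟩ y -
    simp [setExpo]
  · rintro ⟨⟨b, τ⟩, f⟩ -
    simp [setExpo]
  · rintro ⟨⟨b, τ⟩, f⟩ y y' -
    simp [setExpo]
  · rintro ⟨⟨b, τ⟩, f⟩ y ⟨hj, w₁, v₁, w₁', v₁', ha, ha', hv, he⟩
      ⟨-, w₂, v₂, w₂', v₂', hb, hb', -, he'⟩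
    simp only at *
    rw [symAction_setExpo hm i D sim A b τ f t y hj.le, ha] at hb
    rw [symAction_setExpo hm i D sim A b τ f t y le_rfl, ha'] at hb'
    cases hb
    cases hb'
    have e1 : (setExpo b t y).exp j = b.exp j := by
      simp [setExpo, Base.exp, Function.update_of_ne hj.ne]
    have e2 : (setExpo b t y).exp t = (y : ℕ) + 1 := by simp [setExpo, Base.exp]
    rw [e1, he, e2] at he'
    exact pow_exponent_injective hv he'

/-- Two runs with initiators, one the target and the other sharing a hidden group with it, have the
same Diffie-Hellman value. -/
def ValueMatch {N : ℕ} (i : P.Node) (D : Finset P.Grp) (b : Base P N)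
    (S : Fin N → Option (Session P)) : Prop :=
  ∃ (r r' : Fin N) (w : Party P) (u u' : P.Elem), r ≠ r' ∧
    S r = some ⟨.target, .initiator, some u⟩ ∧ S r' = some ⟨w, .initiator, some u'⟩ ∧
    SharesHidden i D w ∧ u ^ b.exp r = u' ^ b.exp r'

/-- Go to the first occurrences of the two colliding points; the later of these is new when it
appears, as the resampling of `kdf` requires. -/
theorem exists_new_collision {n : ℕ} {Z K : Type} (g : Fin n → Z) (h : Z → K) {j j' : Fin n}
    (hne : g j ≠ g j') (heq : h (g j) = h (g j')) :
    ∃ p : Fin n × Fin n, p.2 < p.1 ∧ (∀ l < p.1, g l ≠ g p.1) ∧ h (g p.1) = h (g p.2) := by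
  have first : ∀ j : Fin n, ∃ l, g l = g j ∧ ∀ l' < l, g l' ≠ g l := by
    intro j
    obtain ⟨l, hl, hmin⟩ :=
      WellFounded.has_min (wellFounded_lt (α := Fin n)) {l | g l = g j} ⟨j, rfl⟩
    exact ⟨l, hl, fun l' hl' e => hmin l' (e.trans hl) hl'⟩
  obtain ⟨l, hl, hl'⟩ := first j
  obtain ⟨k, hk, hk'⟩ := first j'
  rcases lt_trichotomy l k with hlt | rfl | hlt
  · exact ⟨(k, l), hlt, hk', by simp only [hl, hk, heq]⟩
  · exact absurd (hl.symm.trans hk) hne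
  · exact ⟨(l, k), hlt, hl', by simp only [hl, hk, heq]⟩

theorem symProb_keyMatch_le :
    symProb hm i D sim A (fun x a =>
        KeyMatch i D x.1 (stateAt hm D A x.1 x.2 a A.rounds).sessions ∧
        ¬ ValueMatch i D x.1 (stateAt hm D A x.1 x.2 a A.rounds).sessions) ≤
      (A.rounds : ℝ) ^ 2 / Nat.card P.Key +
        (A.rounds : ℝ) ^ 2 / (Nat.card P.Elem - 1 : ℕ) := by
  have hsum : ∀ d : ℝ, (A.rounds : ℝ) ^ 2 / d = ∑ _p : Fin A.rounds × Fin A.rounds, 1 / d := by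
    intro d
    simp only [Finset.sum_const, Finset.card_univ, Fintype.card_prod, Fintype.card_fin,
      nsmul_eq_mul]
    push_cast
    ring
  rw [hsum, hsum]
  refine le_trans (prob_mono ?_) ((prob_or_le _ _).trans (add_le_add
    ((prob_exists_le _).trans (Finset.sum_le_sum fun p _ =>
      prob_kdf_collision_le hm i D sim A p.1 p.2))
    ((prob_exists_le _).trans (Finset.sum_le_sum fun p _ =>
      prob_responder_collision_le hm i D sim A p.1 p.2))))
  rintro ⟨⟨b, τ⟩, f⟩ ⟨⟨r, r', w, ρ, u, u', hr, hS, hS', hw, hk⟩, hV⟩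
  simp only at *
  by_cases hz : u ^ b.exp r = u' ^ b.exp r'
  · right
    cases ρ with
    | initiator => exact absurd ⟨r, r', w, u, u', hr, hS, hS', hw, hz⟩ hV
    | responder =>
      obtain ⟨v, e, hv, ha⟩ := respond_of_session hm D A b τ _ le_rfl hS
      obtain ⟨v', e', hv', ha'⟩ := respond_of_session hm D A b τ _ le_rfl hS'
      cases e
      cases e'
      rw [actionAt_answers] at ha ha'
      -- The run that started later comes first in the pair: its exponent is the one resampled.
      rcases lt_or_gt_of_ne hr with hlt | hlt
      · exact ⟨(r', r), hlt, _, _, _, _, ha, ha', hv', hz⟩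
      · exact ⟨(r, r'), hlt, _, _, _, _, ha', ha, hv, hz.symm⟩
  · left
    rw [stateAt_answers] at hS hS'
    obtain ⟨j, -, hj⟩ := touch_symState hm i D sim A b τ f le_rfl hS
    obtain ⟨j', -, hj'⟩ := touch_symState hm i D sim A b τ f le_rfl hS'
    exact exists_new_collision (symTouch hm i D sim A b τ f) b.kdf (j := j) (j' := j')
      (by rwa [hj, hj']) (by rwa [hj, hj'])

end Resampling

/-! ### Concrete bounds on the advantage. -/

section Bounds

variable {P : Setup} (hm : 0 < P.m) (i : P.Node) (D : Finset P.Grp) (A : Adversary P)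

theorem prob_final_eq_realProb (sim : Bool)
    (Φ : Base P A.rounds → A.Tape → State P A.rounds → Prop) :
    prob (fun x : Coins P A.rounds × A.Tape => Φ (coinsEquiv x.1).1 x.2 (final i D sim A x)) =
      realProb hm i D sim A (fun y a => Φ y.1 y.2 (stateAt hm D A y.1 y.2 a A.rounds)) := by
  let e : Coins P A.rounds × A.Tape ≃
      (Base P A.rounds × A.Tape) × (Role × P.Key × P.Secret → P.Digest) :=
    { toFun := fun x => (((coinsEquiv x.1).1, x.2), (coinsEquiv x.1).2)
      invFun := fun y => (coinsEquiv.symm (y.1.1, y.2), y.1.2)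
      left_inv := fun _ => rfl
      right_inv := fun y => by simp }
  unfold realProb
  rw [← prob_equiv e]
  refine prob_congr fun x => ?_
  simp only [stateAt, traj_answers, final, play_eq_run hm]
  rfl

/-- A bound for the advantage of an adversary, if no clash occurs. -/
noncomputable def advantageBound (P : Setup) (N : ℕ) : ℝ :=
  2 * ((N * P.m : ℝ) ^ 2 / Nat.card P.Secret) + (N : ℝ) ^ 2 / Nat.card P.Key +
    (N : ℝ) ^ 2 / (Nat.card P.Elem - 1 : ℕ)

/-- The secret-collision term is paid twice, for entering and leaving the symbolic game. The
key-match term is paid once: both symbolic probabilities exceed the same number by at most that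
term. -/
theorem abs_realProb_sub_realProb_le (hi : ∃ G ∈ D, G ∈ P.groups i)
    (E : Base P A.rounds × A.Tape → (Fin A.rounds → Fin P.m → P.Digest) → Prop)
    (hE : ∀ x a, E x a → ¬ ValueMatch i D x.1 (stateAt hm D A x.1 x.2 a A.rounds).sessions) :
    |realProb hm i D false A E - realProb hm i D true A E| ≤ advantageBound P A.rounds := by
  have h0 := abs_le.1 (abs_realProb_sub_symProb_le hm i D false A hi E)
  have h1 := abs_le.1 (abs_realProb_sub_symProb_le hm i D true A hi E)
  have h2 := symProb_false_eq_true hm i D A hi E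
  have h3 : ∀ sim,
      symProb hm i D sim A (fun x a => E x a ∧
        ¬ KeyMatch i D x.1 (stateAt hm D A x.1 x.2 a A.rounds).sessions) ≤
      symProb hm i D sim A E ∧
      symProb hm i D sim A E ≤
      symProb hm i D sim A (fun x a => E x a ∧
        ¬ KeyMatch i D x.1 (stateAt hm D A x.1 x.2 a A.rounds).sessions) +
      ((A.rounds : ℝ) ^ 2 / Nat.card P.Key +
        (A.rounds : ℝ) ^ 2 / (Nat.card P.Elem - 1 : ℕ)) := by
    intro sim
    refine ⟨prob_mono fun x h => h.1, ?_⟩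
    have e : symProb hm i D sim A (fun x a => E x a ∧
          KeyMatch i D x.1 (stateAt hm D A x.1 x.2 a A.rounds).sessions) +
        symProb hm i D sim A (fun x a => E x a ∧
          ¬ KeyMatch i D x.1 (stateAt hm D A x.1 x.2 a A.rounds).sessions) =
        symProb hm i D sim A E := prob_and_add_and_not _ _
    have l : symProb hm i D sim A (fun x a => E x a ∧
          KeyMatch i D x.1 (stateAt hm D A x.1 x.2 a A.rounds).sessions) ≤ _ :=
      (prob_mono fun x h => ⟨h.2, hE _ _ h.1⟩).trans (symProb_keyMatch_le hm i D sim A)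
    linarith
  have hf := h3 false
  have ht := h3 true
  unfold advantageBound
  rw [abs_le]
  constructor <;> linarith

/-- The predicate `g` is left general because the constant `True` compares the probabilities of a
clash in the two experiments. -/
theorem abs_prob_noClash_sub_le (hi : ∃ G ∈ D, G ∈ P.groups i)
    (g : A.Tape → List (Reply P) → Prop) :
    |prob (fun x => g x.2 (final i D false A x).replies ∧ ¬ Clash i D false A x) -
      prob (fun x => g x.2 (final i D true A x).replies ∧ ¬ Clash i D true A x)| ≤
      advantageBound P A.rounds := by
  -- The node `i` has a group, so its array has a cell.
  have hm : 0 < P.m := by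
    obtain ⟨G, -, hG⟩ := hi
    exact (Finset.card_pos.2 ⟨G, hG⟩).trans_le (P.card_groups_le i)
  have h : ∀ sim, prob (fun x => g x.2 (final i D sim A x).replies ∧ ¬ Clash i D sim A x) = _ :=
    fun sim => prob_final_eq_realProb hm i D A sim fun b τ s =>
      g τ s.replies ∧ ¬ ValueMatch i D b s.sessions
  rw [h, h]
  exact abs_realProb_sub_realProb_le hm i D A hi _ fun x a h => h.2

theorem abs_prob_accepts_noClash_sub_le (hi : ∃ G ∈ D, G ∈ P.groups i) :
    |prob (fun x => Accepts i D false A x ∧ ¬ Clash i D false A x) -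
      prob (fun x => Accepts i D true A x ∧ ¬ Clash i D true A x)| ≤
      advantageBound P A.rounds :=
  abs_prob_noClash_sub_le i D A hi fun τ l => A.guess τ l = true

theorem abs_prob_accepts_sub_le (hi : ∃ G ∈ D, G ∈ P.groups i) :
    |prob (Accepts i D false A) - prob (Accepts i D true A)| ≤
      prob (Clash i D false A) + 2 * advantageBound P A.rounds := by
  have h1 := abs_le.1 (abs_prob_accepts_noClash_sub_le i D A hi)
  have h2 := abs_le.1 (abs_prob_noClash_sub_le i D A hi fun _ _ => True)
  simp only [true_and] at h2
  rw [prob_not, prob_not] at h2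
  have e : ∀ sim, prob (fun x => Accepts i D sim A x ∧ Clash i D sim A x) +
      prob (fun x => Accepts i D sim A x ∧ ¬ Clash i D sim A x) = prob (Accepts i D sim A) :=
    fun sim => prob_and_add_and_not _ _
  have l : ∀ sim, 0 ≤ prob (fun x => Accepts i D sim A x ∧ Clash i D sim A x) ∧
      prob (fun x => Accepts i D sim A x ∧ Clash i D sim A x) ≤ prob (Clash i D sim A) :=
    fun sim => ⟨prob_nonneg _, prob_mono fun x h => h.2⟩
  have ef := e false
  have et := e true
  have lf := l false
  have lt := l true
  rw [abs_le]
  constructor <;> linarith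

end Bounds

/-! ### Asymptotics in the security parameter. -/

section Asymptotics

theorem PolyBounded.eventually_le_pow {f : ℕ → ℕ} (hf : PolyBounded f) :
    ∃ c : ℕ, ∀ᶠ σ in atTop, f σ ≤ σ ^ c := by
  obtain ⟨p, hp⟩ := hf
  -- The extra power of `σ` absorbs the sum of the coefficients.
  refine ⟨p.natDegree + 1, ?_⟩
  filter_upwards [eventually_ge_atTop (∑ k ∈ Finset.range (p.natDegree + 1), p.coeff k),
    eventually_ge_atTop 1] with σ h1 h2
  refine (hp σ).trans ?_
  rw [Polynomial.eval_eq_sum_range]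
  calc ∑ k ∈ Finset.range (p.natDegree + 1), p.coeff k * σ ^ k
      ≤ ∑ k ∈ Finset.range (p.natDegree + 1), p.coeff k * σ ^ p.natDegree := by
        refine Finset.sum_le_sum fun k hk => Nat.mul_le_mul_left _ (Nat.pow_le_pow_right h2 ?_)
        exact Nat.lt_succ_iff.1 (Finset.mem_range.1 hk)
    _ = (∑ k ∈ Finset.range (p.natDegree + 1), p.coeff k) * σ ^ p.natDegree := by
        rw [Finset.sum_mul]
    _ ≤ σ * σ ^ p.natDegree := Nat.mul_le_mul_right _ h1
    _ = σ ^ (p.natDegree + 1) := by rw [pow_succ, mul_comm]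

theorem div_le_of_large {σ c n X : ℕ} (hσ : 0 < σ) (hn : n ≤ σ ^ c)
    (hX : σ ^ (c + 1) * 2 ^ σ ≤ X) : (n : ℝ) / X ≤ 1 / (σ * 2 ^ σ) := by
  have hX0 : 0 < X := lt_of_lt_of_le (by positivity) hX
  rw [div_le_div_iff₀ (by exact_mod_cast hX0) (by positivity), one_mul]
  have : n * (σ * 2 ^ σ) ≤ X :=
    calc n * (σ * 2 ^ σ) ≤ σ ^ c * (σ * 2 ^ σ) := Nat.mul_le_mul_right _ hn
      _ = σ ^ (c + 1) * 2 ^ σ := by ring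
      _ ≤ X := hX
  exact_mod_cast this

theorem eventually_advantageBound_lt (P : ℕ → Setup) (N : ℕ → ℕ)
    (hm : PolyBounded fun σ => (P σ).m) (hElem : Large fun σ => Nat.card (P σ).Elem)
    (hKey : Large fun σ => Nat.card (P σ).Key) (hSecret : Large fun σ => Nat.card (P σ).Secret)
    (hN : PolyBounded N) :
    ∀ᶠ σ in atTop, 2 * advantageBound (P σ) (N σ) < 1 / 2 ^ σ := by
  obtain ⟨c, hc⟩ := hm.eventually_le_pow
  obtain ⟨d, hd⟩ := hN.eventually_le_pow
  -- Each `+ 1` leaves a spare factor `σ` in the denominator to beat the constant 10.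
  filter_upwards [hc, hd, hElem (d * 2 + 1), hKey (d * 2 + 1), hSecret ((d + c) * 2 + 1),
    eventually_gt_atTop 10] with σ hc hd hE hK hS hσ
  have hσ0 : 0 < σ := by omega
  have hNN : N σ ^ 2 ≤ σ ^ (d * 2) := by rw [pow_mul]; exact Nat.pow_le_pow_left hd 2
  have hNm : (N σ * (P σ).m) ^ 2 ≤ σ ^ ((d + c) * 2) := by
    rw [pow_mul, pow_add]
    exact Nat.pow_le_pow_left (Nat.mul_le_mul hd hc) 2
  have h1 := div_le_of_large hσ0 hNm hS
  have h2 := div_le_of_large hσ0 hNN hK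
  have h3 := div_le_of_large hσ0 hNN hE
  push_cast at h1 h2 h3
  have hq := (P σ).card_prime.two_le
  -- Uses `q - 1 ≥ q / 2`.
  have h4 : (N σ : ℝ) ^ 2 / (Nat.card (P σ).Elem - 1 : ℕ) ≤
      2 * ((N σ : ℝ) ^ 2 / Nat.card (P σ).Elem) := by
    rw [Nat.cast_sub (by omega), ← mul_div_assoc]
    have hq' : (2 : ℝ) ≤ Nat.card (P σ).Elem := by exact_mod_cast hq
    rw [div_le_div_iff₀ (by push_cast; linarith) (by linarith)]
    push_cast
    nlinarith [sq_nonneg (N σ : ℝ)]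
  -- The terms of `advantageBound` contribute 2, 1 and 2 units of `1 / (σ * 2 ^ σ)`, and the bound
  -- is doubled.
  have h5 : 10 * (1 / (σ * 2 ^ σ) : ℝ) < 1 / 2 ^ σ := by
    have : (10 : ℝ) < σ := by exact_mod_cast hσ
    rw [mul_one_div, div_lt_div_iff₀ (by positivity) (by positivity), one_mul]
    exact mul_lt_mul_of_pos_right this (by positivity)
  unfold advantageBound
  linarith

end Asymptotics

end Handshake

theorem mainTheorem2
    (P : ℕ → Handshake.Setup)
    (hm : Handshake.PolyBounded fun σ => (P σ).m)
    (hElem : Handshake.Large fun σ => Nat.card (P σ).Elem)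
    (hKey : Handshake.Large fun σ => Nat.card (P σ).Key)
    (hSecret : Handshake.Large fun σ => Nat.card (P σ).Secret)
    (i : ∀ σ, (P σ).Node) (G : ∀ σ, (P σ).Grp) (D : ∀ σ, Finset (P σ).Grp)
    (hi : ∀ σ, G σ ∈ (P σ).groups (i σ)) (hD : ∀ σ, G σ ∈ D σ)
    (A : ∀ σ, Handshake.Adversary (P σ))
    (hA : Handshake.PolyBounded fun σ => (A σ).rounds) :
    ∀ᶠ σ in Filter.atTop,
      |Handshake.prob (fun x => Handshake.Accepts (i σ) (D σ) false (A σ) x ∧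
            ¬ Handshake.Clash (i σ) (D σ) false (A σ) x)
          - Handshake.prob (fun x => Handshake.Accepts (i σ) (D σ) true (A σ) x ∧
            ¬ Handshake.Clash (i σ) (D σ) true (A σ) x)| < 1 / 2 ^ σ
      ∧
      |Handshake.prob (Handshake.Accepts (i σ) (D σ) false (A σ))
          - Handshake.prob (Handshake.Accepts (i σ) (D σ) true (A σ))|
        < Handshake.prob (Handshake.Clash (i σ) (D σ) false (A σ)) + 1 / 2 ^ σ := by
  filter_upwards [Handshake.eventually_advantageBound_lt P (fun σ => (A σ).rounds) hm hElem hKey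
    hSecret hA] with σ hσ
  have hi' : ∃ H ∈ D σ, H ∈ (P σ).groups (i σ) := ⟨G σ, hD σ, hi σ⟩
  have h1 := Handshake.abs_prob_accepts_noClash_sub_le (i σ) (D σ) (A σ) hi'
  have h2 := Handshake.abs_prob_accepts_sub_le (i σ) (D σ) (A σ) hi'
  have h0 : 0 ≤ Handshake.advantageBound (P σ) (A σ).rounds := (abs_nonneg _).trans h1
  exact ⟨by linarith, by linarith⟩
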